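/- Let $\Omega\subset\mathbb R^2$ be a bounded polygonal domain with Lipschitz boundary, let $\alpha\in[0,1]$, let $u(x_1,x_2)=x_1^2+x_2^2$, and let $C(u)\in\mathbb R$. For a conforming triangulation $\mathcal T_h$ of $\Omega$ all of whose elements have diameter at most $h>0$, let $X_h$ be the space of continuous functions on $\overline\Omega$ that are affine on each element. A straight band of length $L$ in $\mathcal T_h$ is a union $\mathcal B=\bigcup_{i=0}^N K_i\cup\bigcup_{i=1}^N\tilde K_i$, $N\ge 1$, of elements $K_i=P_iA_iP_{i+1}$ $(0\le i\le N)$ and $\tilde K_i=A_{i-1}P_iA_i$ $(1\le i\le N)$ of $\mathcal T_h$, where $P_0,P_1,\dots,P_{N+1}$ are distinct points lying in this order on a line, $L=|P_0P_{N+1}|$, the maximum angle $\alpha_i$ of $K_i$ is attained at the vertex $A_i$ (so the longest edge of $K_i$ is $P_iP_{i+1}$), and the maximum angle $\tilde\alpha_i$ of $\tilde K_i$ is attained at the vertex $P_i$. The area of a triangle $K$ is denoted by $|K|$, and $|v|_{H^1(S)}=\bigl(\int_S|\nabla v|^2\,dx\bigr)^{1/2}$. Then there are constants $C_L,C_1>0$,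 depending only on $\Omega$, $\alpha$ and $C(u)$, and for all $C_K,C_\alpha\in\mathbb R$ a constant $C_2>0$, depending only on $\Omega,\alpha,C(u),C_K,C_\alpha$, such that the following holds for every $h>0$, every such triangulation $\mathcal T_h$, every $U\in X_h$ and every straight band $\mathcal B$ in $\mathcal T_h$. If $$|u-U|_{H^1(\Omega)}\le C(u)h^\alpha,$$ $$|\tilde K_i|\le C_K|K_i|,\qquad |\tilde K_i|\le C_K|K_{i-1}|,\qquad \sin(\pi-\alpha_{i-1})\le C_\alpha\sin(\pi-\tilde\alpha_i)\qquad(i=1,\dots,N),$$ and $L\ge C_Lh^{2\alpha/5}$, then $$|u-U|_{H^1(\mathcal B)}\ge \mathcal A_1-\mathcal A_2$$ for some real numbers $\mathcal A_1,\mathcal A_2$ with $$\mathcal A_1\ge C_1\min_{1\le i\le N}\frac1{\sin(\pi-\tilde\alpha_i)}\ \min_{1\le i\le N}|\tilde K_i|^{1/2}\ L\,N^{-1/2},\qquad |\mathcal A_2|\le C_2h^\alpha .$$ -/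

import Mathlib

open MeasureTheory

noncomputable section

namespace FEMBand

/-- The Euclidean plane. -/
abbrev Plane : Type := EuclideanSpace ℝ (Fin 2)

/-- The boundary of `Ω` is Lipschitz: near each boundary point, in a suitable orthonormal
coordinate system, `Ω` is the region strictly above the graph of a Lipschitz function. -/
def HasLipschitzBoundary (Ω : Set Plane) : Prop :=
  ∀ x ∈ frontier Ω, ∃ (R : Plane ≃ₗᵢ[ℝ] Plane) (φ : ℝ → ℝ) (M : NNReal) (r : ℝ),
    LipschitzWith M φ ∧ 0 < r ∧ ∀ y ∈ Metric.ball x r, (y ∈ Ω ↔ φ (R y 0) < R y 1)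

/-- Bounded polygonal domains with Lipschitz boundary. -/
structure IsPolygonalLipschitzDomain (Ω : Set Plane) : Prop where
  isOpen : IsOpen Ω
  isConnected : IsConnected Ω
  isBounded : Bornology.IsBounded Ω
  polygonal : ∃ S : Set (Plane × Plane), S.Finite ∧ frontier Ω ⊆ ⋃ p ∈ S, segment ℝ p.1 p.2
  lipschitz : HasLipschitzBoundary Ω

/-- `T` is a conforming triangulation of `Ω`: a finite geometric simplicial complex (its simplices
meet only along common faces) which covers exactly the closure of `Ω`. -/
def IsTriangulation (T : Geometry.SimplicialComplex ℝ Plane) (Ω : Set Plane) : Prop :=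
  T.faces.Finite ∧ T.space = closure Ω

/-- The elements (nondegenerate triangles) of `T`, given by their vertex sets. -/
def elements (T : Geometry.SimplicialComplex ℝ Plane) : Set (Finset Plane) :=
  {K | K ∈ T.faces ∧ K.card = 3}

/-- The space of globally continuous, piecewise linear functions on `T`. -/
def piecewiseLinear (T : Geometry.SimplicialComplex ℝ Plane) : Set (Plane → ℝ) :=
  {U | ContinuousOn U T.space ∧
    ∀ K ∈ elements T, ∃ f : Plane →ᵃ[ℝ] ℝ, Set.EqOn U f (convexHull ℝ (K : Set Plane))}

/-- The seminorm `|v|_{H^1(S)}`, for functions `v` that are continuous and piecewise smooth on a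
triangulation: their weak gradient is the classical one, which exists off the edges, that is,
almost everywhere. -/
def h1Seminorm (S : Set Plane) (v : Plane → ℝ) : ℝ :=
  Real.sqrt (∫ x in S, ‖gradient v x‖ ^ 2)

/-- The quadratic function `x₁² + x₂²`. -/
def quadratic (x : Plane) : ℝ := x 0 ^ 2 + x 1 ^ 2

/-- The closed triangle with vertices `a`, `b`, `c`. -/
def triangle (a b c : Plane) : Set Plane := convexHull ℝ {a, b, c}

/-- The area of the triangle with vertices `a`, `b`, `c`. -/
def area (a b c : Plane) : ℝ := (volume (triangle a b c)).toReal

/-- The maximum angle of the triangle with vertices `a`, `b`, `c`. -/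
def maxAngle (a b c : Plane) : ℝ :=
  max (EuclideanGeometry.angle b a c)
    (max (EuclideanGeometry.angle a b c) (EuclideanGeometry.angle a c b))

/-- `a`, `b`, `c` are the vertices of an element of `T`. -/
def IsElement (T : Geometry.SimplicialComplex ℝ Plane) (a b c : Plane) : Prop :=
  ∃ K ∈ elements T, (K : Set Plane) = {a, b, c}

/-- A straight band in `T`, consisting of the elements `K_i` with vertices `P_i, A_i, P_{i+1}`
(`0 ≤ i ≤ N`) and `K̃_i` with vertices `A_{i-1}, P_i, A_i` (`1 ≤ i ≤ N`). The points `P_i` follow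
each other on a line. The largest angle of `K_i` is at `A_i`, so that `P_i P_{i+1}` is
its longest edge, and the largest angle of `K̃_i` is at `P_i`. Only the values `pos i` with
`i ≤ N + 1` and `apex i` with `i ≤ N` matter. -/
structure StraightBand (T : Geometry.SimplicialComplex ℝ Plane) where
  N : ℕ
  one_le_N : 1 ≤ N
  /-- an endpoint of the straight edge `Γ` -/
  start : Plane
  /-- the direction of `Γ` -/
  dir : Plane
  norm_dir : ‖dir‖ = 1
  /-- the arc length parameter of `P_i` on `Γ` -/
  pos : ℕ → ℝ
  pos_zero : pos 0 = 0
  pos_lt : ∀ i ≤ N, pos i < pos (i + 1)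
  /-- the vertices `A_i` -/
  apex : ℕ → Plane
  elem : ∀ i ≤ N,
    IsElement T (start + pos i • dir) (apex i) (start + pos (i + 1) • dir)
  elem_tilde : ∀ i, 1 ≤ i → i ≤ N →
    IsElement T (apex (i - 1)) (start + pos i • dir) (apex i)
  maxAngle_elem : ∀ i ≤ N,
    maxAngle (start + pos i • dir) (apex i) (start + pos (i + 1) • dir) =
      EuclideanGeometry.angle (start + pos i • dir) (apex i) (start + pos (i + 1) • dir)
  maxAngle_elem_tilde : ∀ i, 1 ≤ i → i ≤ N →
    maxAngle (apex (i - 1)) (start + pos i • dir) (apex i) =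
      EuclideanGeometry.angle (apex (i - 1)) (start + pos i • dir) (apex i)

namespace StraightBand

variable {T : Geometry.SimplicialComplex ℝ Plane} (B : StraightBand T)

/-- The vertex `P_i` on `Γ`. -/
def base (i : ℕ) : Plane := B.start + B.pos i • B.dir

/-- The length `L` of `Γ`. -/
def length : ℝ := B.pos (B.N + 1)

/-- The element `K_i`, `0 ≤ i ≤ N`. -/
def K (i : ℕ) : Set Plane := triangle (B.base i) (B.apex i) (B.base (i + 1))

/-- The element `K̃_i`, `1 ≤ i ≤ N`. -/
def Kt (i : ℕ) : Set Plane := triangle (B.apex (i - 1)) (B.base i) (B.apex i)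

/-- The area `|K_i|`. -/
def areaK (i : ℕ) : ℝ := area (B.base i) (B.apex i) (B.base (i + 1))

/-- The area `|K̃_i|`. -/
def areaKt (i : ℕ) : ℝ := area (B.apex (i - 1)) (B.base i) (B.apex i)

/-- The maximum angle of `K_i`. -/
def angleK (i : ℕ) : ℝ := maxAngle (B.base i) (B.apex i) (B.base (i + 1))

/-- The maximum angle of `K̃_i`. -/
def angleKt (i : ℕ) : ℝ := maxAngle (B.apex (i - 1)) (B.base i) (B.apex i)

/-- The region covered by the band. -/
def region : Set Plane :=
  (⋃ i ∈ Set.Icc 0 B.N, B.K i) ∪ ⋃ i ∈ Set.Icc 1 B.N, B.Kt i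

/-- The minimum of `f i` over `i = 1, …, N`. -/
def minOver (f : ℕ → ℝ) : ℝ :=
  (Finset.Icc 1 B.N).inf' (Finset.nonempty_Icc.mpr B.one_le_N) f

end StraightBand

end FEMBand

end

/-!
If the slopes of `U` along the line of the band varied by less than `δ L`, the second differences of
`u - U` along that line would be bounded below on a parallelogram with sides comparable to `L`, for
which the Lipschitz boundary leaves room inside `Ω`. This forces `L ^ 5` to be at most a constant
times `|u - U|_{H¹(Ω)}²`, hence times `h ^ (2 α)`, which a large `C_L` excludes. So the slopes
oscillate by at least `δ L` along the band. On the other hand the gradients of `U` on neighbouring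
elements agree along the common edge, so the jump of the slope at `P i` is at most `sin (π - α̃ i)`
times the deviation of the gradients of `U` from `∇u (P i)` on the three elements meeting there.
Summing these jumps by Cauchy–Schwarz, weighted with the element areas, bounds the oscillation by
`N ^ (1 / 2)` times the `H¹` error up to an interpolation term of order `h`. Both are `O(h ^ α)`, so
the lower bound asked of `A₁` never exceeds `C₂ h ^ α`, and `A₁ = A₂ = C₂ h ^ α` is admissible.
-/

namespace FEMBand

section InnerProductSpace

variable {E : Type*} [NormedAddCommGroup E] [InnerProductSpace ℝ E]

theorem abs_inner_mul_norm_le (g d e : E) :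
    |inner ℝ g d| * ‖e‖ ≤
      |inner ℝ g e| * ‖d‖ + Real.sin (InnerProductGeometry.angle d e) * (‖g‖ * ‖d‖ * ‖e‖) := by
  rcases eq_or_ne e 0 with rfl | he
  · simp
  set f := ‖e‖ ^ 2 • d - inner ℝ d e • e
  have hf : ‖f‖ = ‖e‖ * (Real.sin (InnerProductGeometry.angle d e) * (‖d‖ * ‖e‖)) := by
    rw [InnerProductGeometry.sin_angle_mul_norm_mul_norm,
      ← Real.sqrt_sq (norm_nonneg e), ← Real.sqrt_mul (by positivity),
      ← Real.sqrt_sq (norm_nonneg f)]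
    congr 1
    simp only [f, @norm_sub_sq_real, norm_smul, inner_smul_left, inner_smul_right,
      real_inner_self_eq_norm_sq, norm_pow, mul_pow, Real.norm_eq_abs, sq_abs,
      conj_trivial]
    ring
  have hg : ‖e‖ ^ 2 * inner ℝ g d = inner ℝ g f + inner ℝ d e * inner ℝ g e := by
    simp only [f, inner_sub_right, inner_smul_right]
    ring
  refine le_of_mul_le_mul_left ?_ (norm_pos_iff.2 he)
  calc ‖e‖ * (|inner ℝ g d| * ‖e‖) = |‖e‖ ^ 2 * inner ℝ g d| := by
        rw [abs_mul, abs_of_nonneg (by positivity : 0 ≤ ‖e‖ ^ 2)]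
        ring
    _ ≤ |inner ℝ g f| + |inner ℝ d e * inner ℝ g e| := hg ▸ abs_add_le _ _
    _ ≤ ‖g‖ * ‖f‖ + ‖d‖ * ‖e‖ * |inner ℝ g e| := by
        rw [abs_mul]
        gcongr <;> exact abs_real_inner_le_norm _ _
    _ = _ := by
        rw [hf]
        ring

/-- The affine hyperplane with normal vector `z.1` and offset `z.2`. -/
def hyperplane (z : E × ℝ) : Set E := {x | inner ℝ z.1 x = z.2}

theorem finite_setOf_add_smul_mem_hyperplane {Z : Set (E × ℝ)} (hZ : Z.Finite) {q v : E}
    (hq : ∀ z ∈ Z, inner ℝ z.1 v = 0 → q ∉ hyperplane z) :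
    {t : ℝ | ∃ z ∈ Z, q + t • v ∈ hyperplane z}.Finite := by
  have hunion : {t : ℝ | ∃ z ∈ Z, q + t • v ∈ hyperplane z} =
      ⋃ z ∈ Z, {t : ℝ | q + t • v ∈ hyperplane z} := by
    ext
    simp
  rw [hunion]
  refine hZ.biUnion fun z hz => Set.Subsingleton.finite fun s hs t ht => ?_
  simp only [hyperplane, Set.mem_ofPred_eq, inner_add_right, inner_smul_right] at hs ht
  by_cases hv : inner ℝ z.1 v = 0
  · exact absurd (by simpa [hyperplane, hv] using hs) (hq z hz hv)
  · exact mul_right_cancel₀ hv (by linarith)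

variable [CompleteSpace E]

theorem inner_gradient_left (w : E → ℝ) (x v : E) : inner ℝ (gradient w x) v = fderiv ℝ w x v :=
  InnerProductSpace.toDual_symm_apply

theorem measurable_gradient [MeasurableSpace E] [BorelSpace E] (w : E → ℝ) :
    Measurable (gradient w) :=
  (InnerProductSpace.toDual ℝ E).symm.continuous.measurable.comp (measurable_fderiv ℝ w)

theorem enorm_sub_le_lintegral_gradient {w : E → ℝ} {q v : E} {s t : ℝ} (hst : s ≤ t) {F : Set ℝ}
    (hF : F.Countable) (hcont : ContinuousOn (fun τ : ℝ => w (q + τ • v)) (Set.Icc s t))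
    (hdiff : ∀ τ ∈ Set.Icc s t, τ ∉ F → DifferentiableAt ℝ w (q + τ • v)) :
    ‖w (q + t • v) - w (q + s • v)‖ₑ ≤
      ‖v‖ₑ * ∫⁻ τ in Set.Icc s t, ‖gradient w (q + τ • v)‖ₑ := by
  borelize E
  have hline : Continuous fun τ : ℝ => q + τ • v := by fun_prop
  have hgrad : Measurable fun τ : ℝ => ‖gradient w (q + τ • v)‖ₑ :=
    ((measurable_gradient w).comp hline.measurable).enorm
  have hle : ∀ τ : ℝ, ‖fderiv ℝ w (q + τ • v) v‖ₑ ≤ ‖v‖ₑ * ‖gradient w (q + τ • v)‖ₑ := by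
    intro τ
    rw [← inner_gradient_left, ← ofReal_norm, ← ofReal_norm, ← ofReal_norm,
      ← ENNReal.ofReal_mul (norm_nonneg _), mul_comm]
    exact ENNReal.ofReal_le_ofReal (norm_inner_le_norm _ _)
  have hint : ∫⁻ τ in Set.Icc s t, ‖fderiv ℝ w (q + τ • v) v‖ₑ ≤
      ‖v‖ₑ * ∫⁻ τ in Set.Icc s t, ‖gradient w (q + τ • v)‖ₑ :=
    lintegral_const_mul ‖v‖ₑ hgrad ▸ lintegral_mono hle
  -- If the right-hand side is infinite there is nothing to show; otherwise the derivative along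
  -- the segment is integrable and the fundamental theorem of calculus applies.
  rcases eq_or_ne (‖v‖ₑ * ∫⁻ τ in Set.Icc s t, ‖gradient w (q + τ • v)‖ₑ) ⊤ with htop | htop
  · exact htop ▸ le_top
  have hintegrable : IntegrableOn (fun τ => fderiv ℝ w (q + τ • v) v) (Set.Icc s t) :=
    ⟨((measurable_fderiv_apply_const ℝ w v).comp hline.measurable).aestronglyMeasurable,
      hint.trans_lt htop.lt_top⟩
  have hftc : ∫ τ in s..t, fderiv ℝ w (q + τ • v) v = w (q + t • v) - w (q + s • v) := by
    refine integral_eq_of_hasDerivAt_off_countable (fun τ => w (q + τ • v)) _ hF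
      (by rwa [Set.uIcc_of_le hst]) ?_ ?_
    · rintro τ ⟨hτ, hτF⟩
      rw [min_eq_left hst, max_eq_right hst] at hτ
      have hline' : HasDerivAt (fun τ : ℝ => q + τ • v) v τ := by
        simpa using ((hasDerivAt_id τ).smul_const v).const_add q
      exact (hdiff τ (Set.Ioo_subset_Icc_self hτ) hτF).hasFDerivAt.comp_hasDerivAt τ hline'
    · rw [intervalIntegrable_iff_integrableOn_Ioc_of_le hst]
      exact hintegrable.mono_set Set.Ioc_subset_Icc_self
  rw [← hftc, intervalIntegral.integral_of_le hst]
  exact (enorm_integral_le_lintegral_enorm _).trans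
    ((lintegral_mono_set Set.Ioc_subset_Icc_self).trans hint)

/-- `w` is continuous on `X`, and differentiable at the points of `X` that lie on none of the
finitely many hyperplanes `Z`. -/
structure IsPiecewiseSmooth (Z : Set (E × ℝ)) (X : Set E) (w : E → ℝ) : Prop where
  finite : Z.Finite
  normal_ne_zero : ∀ z ∈ Z, z.1 ≠ 0
  continuousOn : ContinuousOn w X
  differentiableAt : ∀ x ∈ X, (∀ z ∈ Z, x ∉ hyperplane z) → DifferentiableAt ℝ w x

theorem IsPiecewiseSmooth.enorm_sub_le {Z : Set (E × ℝ)} {X : Set E} {w : E → ℝ}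
    (hw : IsPiecewiseSmooth Z X w) {q v : E}
    (hq : ∀ z ∈ Z, inner ℝ z.1 v = 0 → q ∉ hyperplane z) {b c s t : ℝ}
    (hX : ∀ τ ∈ Set.Icc b c, q + τ • v ∈ X) (hs : s ∈ Set.Icc b c) (ht : t ∈ Set.Icc b c) :
    ‖w (q + t • v) - w (q + s • v)‖ₑ ≤
      ‖v‖ₑ * ∫⁻ τ in Set.Icc b c, ‖gradient w (q + τ • v)‖ₑ := by
  wlog hst : s ≤ t generalizing s t
  · rw [enorm_sub_rev]
    exact this ht hs (not_le.1 hst).le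
  have hsub : Set.Icc s t ⊆ Set.Icc b c := Set.Icc_subset_Icc hs.1 ht.2
  refine (enorm_sub_le_lintegral_gradient hst
    (finite_setOf_add_smul_mem_hyperplane hw.finite hq).countable
    (hw.continuousOn.comp (by fun_prop) fun τ hτ => hX τ (hsub hτ))
    fun τ hτ hτZ => hw.differentiableAt _ (hX τ (hsub hτ)) fun z hz h => hτZ ⟨z, hz, h⟩).trans ?_
  gcongr

end InnerProductSpace

theorem lintegral_sq_le {β : Type*} [MeasurableSpace β] {μ : Measure β} {f : β → ENNReal}
    (hf : AEMeasurable f μ) : (∫⁻ x, f x ∂μ) ^ 2 ≤ μ Set.univ * ∫⁻ x, f x ^ 2 ∂μ := by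
  have h := ENNReal.lintegral_mul_le_Lp_mul_Lq μ Real.HolderConjugate.two_two
    (aemeasurable_const (b := 1)) hf
  simp only [Pi.mul_apply, one_mul, ENNReal.one_rpow, lintegral_const] at h
  calc (∫⁻ x, f x ∂μ) ^ 2
      ≤ (μ Set.univ ^ (1 / 2 : ℝ) * (∫⁻ x, f x ^ (2 : ℝ) ∂μ) ^ (1 / 2 : ℝ)) ^ 2 := by gcongr
    _ = μ Set.univ * ∫⁻ x, f x ^ 2 ∂μ := by
        rw [mul_pow, ← ENNReal.rpow_mul_natCast, ← ENNReal.rpow_mul_natCast]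
        simp

theorem enorm_secondDifference_le (x₀ x₁ x₂ y₀ y₁ y₂ : ℝ) :
    ‖x₂ - 2 * x₁ + x₀‖ₑ ≤ ‖y₂ - y₁‖ₑ + ‖y₁ - y₀‖ₑ +
      (‖y₀ - x₀‖ₑ + 2 * ‖y₁ - x₁‖ₑ + ‖y₂ - x₂‖ₑ) := by
  have htwo : ‖(2 : ℝ)‖ₑ = 2 := by simp [Real.enorm_eq_ofReal zero_le_two]
  calc ‖x₂ - 2 * x₁ + x₀‖ₑ
      = ‖y₂ - y₁ - (y₁ - y₀) - (y₀ - x₀ - 2 * (y₁ - x₁) + (y₂ - x₂))‖ₑ := by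
        congr 1
        ring
    _ ≤ ‖y₂ - y₁ - (y₁ - y₀)‖ₑ + (‖y₀ - x₀ - 2 * (y₁ - x₁)‖ₑ + ‖y₂ - x₂‖ₑ) :=
        enorm_sub_le.trans (add_le_add_right (enorm_add_le _ _) _)
    _ ≤ _ := by
        rw [← htwo, ← enorm_mul]
        gcongr <;> exact enorm_sub_le

/-- The determinant of the matrix with columns `d` and `v`. -/
noncomputable def det₂ (d v : Plane) : ℝ := d 0 * v 1 - d 1 * v 0

theorem det₂_swap (d v : Plane) : det₂ v d = -det₂ d v := by
  unfold det₂
  ring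

theorem inner_eq_sum_coord (x y : Plane) : inner ℝ x y = x 0 * y 0 + x 1 * y 1 := by
  simp [PiLp.inner_apply, Fin.sum_univ_two, mul_comm]

theorem eq_zero_of_inner_eq_zero_of_det₂_ne_zero {d v n : Plane} (hdet : det₂ d v ≠ 0)
    (hd : inner ℝ n d = 0) (hv : inner ℝ n v = 0) : n = 0 := by
  rw [inner_eq_sum_coord] at hd hv
  unfold det₂ at hdet
  ext i
  fin_cases i
  · refine mul_right_cancel₀ hdet (?_ : n 0 * _ = 0 * _)
    linear_combination v 1 * hd - d 1 * hv
  · refine mul_right_cancel₀ hdet (?_ : n 1 * _ = 0 * _)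
    linear_combination d 0 * hv - v 0 * hd

section Parallelogram

variable {Z : Set (Plane × ℝ)} {X : Set Plane} {w : Plane → ℝ} {p d v : Plane}

theorem IsPiecewiseSmooth.ae_notMem_hyperplane (hw : IsPiecewiseSmooth Z X w)
    (hdet : det₂ d v ≠ 0) (p : Plane) :
    ∀ᵐ s : ℝ, ∀ z ∈ Z, inner ℝ z.1 v = 0 → p + s • d ∉ hyperplane z := by
  have hfin : {s : ℝ | ∃ z ∈ {z ∈ Z | inner ℝ z.1 v = 0}, p + s • d ∈ hyperplane z}.Finite :=
    finite_setOf_add_smul_mem_hyperplane (hw.finite.subset (Set.sep_subset _ _))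
      fun z hz hd => absurd (eq_zero_of_inner_eq_zero_of_det₂_ne_zero hdet hd hz.2)
        (hw.normal_ne_zero z hz.1)
  filter_upwards [measure_eq_zero_iff_ae_notMem.1 (hfin.measure_zero volume)] with s hs z hz hv h
  exact hs ⟨z, ⟨hz, hv⟩, h⟩

theorem IsPiecewiseSmooth.ae_enorm_sub_le (hw : IsPiecewiseSmooth Z X w) (hdet : det₂ d v ≠ 0)
    {S : Set ℝ} {b c : ℝ} (hX : ∀ s ∈ S, ∀ t ∈ Set.Icc b c, p + s • d + t • v ∈ X) :
    ∀ᵐ s : ℝ, s ∈ S → ∀ t ∈ Set.Icc b c, ∀ t' ∈ Set.Icc b c,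
      ‖w (p + s • d + t' • v) - w (p + s • d + t • v)‖ₑ ≤
        ‖v‖ₑ * ∫⁻ τ in Set.Icc b c, ‖gradient w (p + s • d + τ • v)‖ₑ := by
  filter_upwards [hw.ae_notMem_hyperplane hdet p] with s hs hsS t ht t' ht'
  exact hw.enorm_sub_le hs (hX s hsS) ht ht'

theorem IsPiecewiseSmooth.ae_secondDifference_le (hw : IsPiecewiseSmooth Z X w)
    (hdet : det₂ d v ≠ 0) {a : ℝ}
    (hX : ∀ s ∈ Set.Icc 0 (3 * a), ∀ t ∈ Set.Icc 0 a, p + s • d + t • v ∈ X) :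
    ∀ᵐ t : ℝ, t ∈ Set.Icc 0 a → ∀ᵐ s : ℝ, s ∈ Set.Icc 0 a →
      ‖w (p + (s + 2 * a) • d) - 2 * w (p + (s + a) • d) + w (p + s • d)‖ₑ ≤
        2 * ‖d‖ₑ * (∫⁻ σ in Set.Icc 0 (3 * a), ‖gradient w (p + σ • d + t • v)‖ₑ) +
        ‖v‖ₑ * ((∫⁻ τ in Set.Icc 0 a, ‖gradient w (p + s • d + τ • v)‖ₑ) +
          2 * (∫⁻ τ in Set.Icc 0 a, ‖gradient w (p + (s + a) • d + τ • v)‖ₑ) +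
          ∫⁻ τ in Set.Icc 0 a, ‖gradient w (p + (s + 2 * a) • d + τ • v)‖ₑ) := by
  have hhor := hw.ae_enorm_sub_le (p := p) (d := v) (v := d) (S := Set.Icc 0 a)
    (by rwa [det₂_swap, neg_ne_zero]) fun t ht s hs => add_right_comm p (s • d) _ ▸ hX s hs t ht
  have hvert := hw.ae_enorm_sub_le hdet hX
  have hshift (b : ℝ) := (quasiMeasurePreserving_add_right volume b).ae hvert
  filter_upwards [hhor] with t hhor ht
  filter_upwards [hvert, hshift a, hshift (2 * a)] with s h₀ h₁ h₂ hs
  simp only [add_right_comm p (t • v)] at hhor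
  have ha : (0 : ℝ) ∈ Set.Icc 0 a := ⟨le_rfl, ht.1.trans ht.2⟩
  have m₀ : s ∈ Set.Icc 0 (3 * a) := ⟨hs.1, by linarith [hs.2, ha.2]⟩
  have m₁ : s + a ∈ Set.Icc 0 (3 * a) := ⟨by linarith [hs.1, ha.2], by linarith [hs.2, ha.2]⟩
  have m₂ : s + 2 * a ∈ Set.Icc 0 (3 * a) :=
    ⟨by linarith [hs.1, ha.2], by linarith [hs.2, ha.2]⟩
  have v₀ := h₀ m₀ 0 ha t ht
  have v₁ := h₁ m₁ 0 ha t ht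
  have v₂ := h₂ m₂ 0 ha t ht
  simp only [zero_smul, add_zero] at v₀ v₁ v₂
  refine (enorm_secondDifference_le _ _ _ (w (p + s • d + t • v)) (w (p + (s + a) • d + t • v))
    (w (p + (s + 2 * a) • d + t • v))).trans ((add_le_add
      (add_le_add (hhor ht _ m₁ _ m₂) (hhor ht _ m₀ _ m₁))
      (add_le_add (add_le_add v₀ (mul_le_mul_right v₁ 2)) v₂)).trans_eq ?_)
  ring

theorem lintegral_lintegral_add {β γ : Type*} [MeasurableSpace β] [MeasurableSpace γ]
    (μ : Measure β) (ν : Measure γ) {f : β → ENNReal} (hf : Measurable f) (g : γ → ENNReal) :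
    ∫⁻ x, ∫⁻ y, f x + g y ∂ν ∂μ =
      ν Set.univ * (∫⁻ x, f x ∂μ) + μ Set.univ * ∫⁻ y, g y ∂ν := by
  simp only [lintegral_add_left measurable_const, lintegral_const]
  rw [lintegral_add_left (hf.mul_const _), lintegral_mul_const _ hf, lintegral_const, mul_comm,
    mul_comm (μ Set.univ)]

theorem setLIntegral_Icc_add_le {G : ℝ → ENNReal} (hG : Measurable G) {a b c : ℝ}
    (hb : 0 ≤ b) (hc : a + b ≤ c) :
    ∫⁻ s in Set.Icc 0 a, G (s + b) ≤ ∫⁻ s in Set.Icc 0 c, G s := by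
  rw [← (measurePreserving_add_right volume b).setLIntegral_comp_preimage measurableSet_Icc hG]
  exact lintegral_mono_set fun s hs => ⟨by linarith [hs.1], by linarith [hs.2]⟩

theorem setLIntegral_translates_le {G : ℝ → ENNReal} (hG : Measurable G) {a : ℝ} (ha : 0 ≤ a) :
    ∫⁻ s in Set.Icc 0 a, (G s + 2 * G (s + a) + G (s + 2 * a)) ≤
      4 * ∫⁻ s in Set.Icc 0 (3 * a), G s := by
  have hGa : Measurable fun s => G (s + a) := hG.comp (measurable_add_const a)
  have hG2a : Measurable fun s => G (s + 2 * a) := hG.comp (measurable_add_const (2 * a))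
  rw [lintegral_add_right _ hG2a, lintegral_add_left hG, lintegral_const_mul _ hGa]
  calc _ ≤ (∫⁻ s in Set.Icc 0 (3 * a), G s) + 2 * (∫⁻ s in Set.Icc 0 (3 * a), G s) +
        ∫⁻ s in Set.Icc 0 (3 * a), G s :=
        add_le_add (add_le_add (lintegral_mono_set (Set.Icc_subset_Icc_right (by linarith)))
          (mul_le_mul_right (setLIntegral_Icc_add_le hG ha (by linarith)) 2))
          (setLIntegral_Icc_add_le hG (by linarith) (by linarith))
    _ = 4 * ∫⁻ s in Set.Icc 0 (3 * a), G s := by ring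

theorem IsPiecewiseSmooth.secondDifference_mul_le_setLIntegral (hw : IsPiecewiseSmooth Z X w)
    (hdet : det₂ d v ≠ 0) {a c : ℝ} (ha : 0 < a)
    (hX : ∀ s ∈ Set.Icc 0 (3 * a), ∀ t ∈ Set.Icc 0 a, p + s • d + t • v ∈ X)
    (hc : ∀ s ∈ Set.Icc 0 a,
      c ≤ |w (p + (s + 2 * a) • d) - 2 * w (p + (s + a) • d) + w (p + s • d)|) :
    ENNReal.ofReal a * ENNReal.ofReal c ≤ (2 * ‖d‖ₑ + 4 * ‖v‖ₑ) *
      ∫⁻ z in Set.Icc 0 (3 * a) ×ˢ Set.Icc 0 a, ‖gradient w (p + z.1 • d + z.2 • v)‖ₑ := by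
  have hmap : Continuous fun z : ℝ × ℝ => p + z.1 • d + z.2 • v := by fun_prop
  have hf : Measurable fun z : ℝ × ℝ => ‖gradient w (p + z.1 • d + z.2 • v)‖ₑ :=
    ((measurable_gradient w).comp hmap.measurable).enorm
  set J := ∫⁻ z in Set.Icc 0 (3 * a) ×ˢ Set.Icc 0 a, ‖gradient w (p + z.1 • d + z.2 • v)‖ₑ
  let R (t : ℝ) := ∫⁻ σ in Set.Icc 0 (3 * a), ‖gradient w (p + σ • d + t • v)‖ₑ
  let G (s : ℝ) := ∫⁻ τ in Set.Icc 0 a, ‖gradient w (p + s • d + τ • v)‖ₑ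
  have hR : Measurable R := hf.lintegral_prod_left'
  have hG : Measurable G := hf.lintegral_prod_right'
  have hJG : ∫⁻ s in Set.Icc 0 (3 * a), G s = J :=
    (setLIntegral_prod _ hf.aemeasurable).symm
  have hJR : ∫⁻ t in Set.Icc 0 a, R t = J := (setLIntegral_prod_symm _ hf.aemeasurable).symm
  have hGs : ∫⁻ s in Set.Icc 0 a, ‖v‖ₑ * (G s + 2 * G (s + a) + G (s + 2 * a)) ≤
      ‖v‖ₑ * (4 * J) := by
    rw [lintegral_const_mul _ (by fun_prop), ← hJG]
    gcongr
    exact setLIntegral_translates_le hG ha.le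
  have hvol : volume.restrict (Set.Icc 0 a) Set.univ = ENNReal.ofReal a := by simp
  have ha0 : ENNReal.ofReal a ≠ 0 := by simpa using ha
  refine (ENNReal.mul_le_mul_iff_right ha0 ENNReal.ofReal_ne_top).1 ?_
  calc ENNReal.ofReal a * (ENNReal.ofReal a * ENNReal.ofReal c)
      = ∫⁻ _ in Set.Icc 0 a, ∫⁻ _ in Set.Icc 0 a, ENNReal.ofReal c := by
        simp only [lintegral_const, hvol]
        ring
    _ ≤ ∫⁻ t in Set.Icc 0 a, ∫⁻ s in Set.Icc 0 a,
          (2 * ‖d‖ₑ * R t + ‖v‖ₑ * (G s + 2 * G (s + a) + G (s + 2 * a))) := by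
        refine setLIntegral_mono_ae' measurableSet_Icc ?_
        filter_upwards [hw.ae_secondDifference_le hdet hX] with t hdiff ht
        refine setLIntegral_mono_ae' measurableSet_Icc ?_
        filter_upwards [hdiff ht] with s hdiff hs
        refine le_trans ?_ (hdiff hs)
        exact Real.enorm_eq_ofReal_abs _ ▸ ENNReal.ofReal_le_ofReal (hc s hs)
    _ ≤ ENNReal.ofReal a * (2 * ‖d‖ₑ * J) + ENNReal.ofReal a * (‖v‖ₑ * (4 * J)) := by
        rw [lintegral_lintegral_add _ _ (hR.const_mul _), lintegral_const_mul _ hR, hJR, hvol]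
        gcongr
    _ = ENNReal.ofReal a * ((2 * ‖d‖ₑ + 4 * ‖v‖ₑ) * J) := by ring

theorem map_add_smul_add_smul_volume (hdet : det₂ d v ≠ 0) (p : Plane) :
    Measure.map (fun z : ℝ × ℝ => p + z.1 • d + z.2 • v) volume =
      ENNReal.ofReal |(det₂ d v)⁻¹| • (volume : Measure Plane) := by
  let A : Plane →ₗ[ℝ] Plane := Matrix.toLpLin 2 2 !![d 0, v 0; d 1, v 1]
  have hA (y : Plane) : A y = y 0 • d + y 1 • v := by
    ext i
    fin_cases i <;>
      simp [A, Matrix.toLpLin_apply, dotProduct, Fin.sum_univ_two, mul_comm]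
  have hAdet : LinearMap.det A = det₂ d v := by
    simp only [A, Matrix.toLpLin_eq_toLin, LinearMap.det_toLin, Matrix.det_fin_two_of, det₂]
    ring
  have hcoord : MeasurePreserving (fun y : Plane => (y 0, y 1)) volume volume :=
    (volume_preserving_finTwoArrow ℝ).comp (PiLp.volume_preserving_ofLp (ι := Fin 2))
  have hmap : Continuous fun z : ℝ × ℝ => p + z.1 • d + z.2 • v := by fun_prop
  calc Measure.map (fun z : ℝ × ℝ => p + z.1 • d + z.2 • v) volume
      = Measure.map (fun y => p + y) (Measure.map A volume) := by
        rw [← hcoord.map_eq, Measure.map_map hmap.measurable hcoord.measurable,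
          Measure.map_map (measurable_const_add p)
            (LinearMap.continuous_of_finiteDimensional A).measurable]
        congr 1
        ext1 y
        simp [hA, add_assoc]
    _ = ENNReal.ofReal |(det₂ d v)⁻¹| • (volume : Measure Plane) := by
        rw [Measure.map_linearMap_addHaar_eq_smul_addHaar _ (hAdet ▸ hdet), Measure.map_smul,
          map_add_left_eq_self, hAdet]

theorem setLIntegral_oblique_le {f : Plane → ENNReal} (hf : Measurable f) (hXm : MeasurableSet X)
    {p : Plane} (hdet : det₂ d v ≠ 0) {S : Set (ℝ × ℝ)} (hX : ∀ z ∈ S, p + z.1 • d + z.2 • v ∈ X) :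
    ∫⁻ z in S, f (p + z.1 • d + z.2 • v) ≤ ENNReal.ofReal |(det₂ d v)⁻¹| * ∫⁻ x in X, f x := by
  have hmap : Continuous fun z : ℝ × ℝ => p + z.1 • d + z.2 • v := by fun_prop
  rw [← smul_eq_mul, ← lintegral_smul_measure, ← Measure.restrict_smul,
    ← map_add_smul_add_smul_volume hdet p, setLIntegral_map hXm hf hmap.measurable]
  exact lintegral_mono_set hX

theorem sq_setLIntegral_oblique_le {f : Plane → ENNReal} (hf : Measurable f)
    (hXm : MeasurableSet X) {p : Plane} (hdet : det₂ d v ≠ 0) {S : Set (ℝ × ℝ)}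
    (hX : ∀ z ∈ S, p + z.1 • d + z.2 • v ∈ X) :
    (∫⁻ z in S, f (p + z.1 • d + z.2 • v)) ^ 2 ≤
      volume S * (ENNReal.ofReal |(det₂ d v)⁻¹| * ∫⁻ x in X, f x ^ 2) := by
  have hmap : Continuous fun z : ℝ × ℝ => p + z.1 • d + z.2 • v := by fun_prop
  refine (lintegral_sq_le (hf.comp hmap.measurable).aemeasurable).trans ?_
  rw [Measure.restrict_apply_univ]
  gcongr
  exact setLIntegral_oblique_le (hf.pow_const 2) hXm hdet hX

theorem IsPiecewiseSmooth.sq_secondDifference_le (hw : IsPiecewiseSmooth Z X w)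
    (hXm : MeasurableSet X) (hint : IntegrableOn (fun x => ‖gradient w x‖ ^ 2) X) {p : Plane}
    (hdet : det₂ d v ≠ 0) {a c : ℝ} (ha : 0 < a) (hc0 : 0 ≤ c)
    (hX : ∀ s ∈ Set.Icc 0 (3 * a), ∀ t ∈ Set.Icc 0 a, p + s • d + t • v ∈ X)
    (hc : ∀ s ∈ Set.Icc 0 a,
      c ≤ |w (p + (s + 2 * a) • d) - 2 * w (p + (s + a) • d) + w (p + s • d)|) :
    c ^ 2 ≤ 3 * (2 * ‖d‖ + 4 * ‖v‖) ^ 2 / |det₂ d v| * ∫ x in X, ‖gradient w x‖ ^ 2 := by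
  set S := Set.Icc 0 (3 * a) ×ˢ Set.Icc 0 a
  set J := ∫⁻ z in S, ‖gradient w (p + z.1 • d + z.2 • v)‖ₑ
  set Q := ∫ x in X, ‖gradient w x‖ ^ 2
  set b := 2 * ‖d‖ + 4 * ‖v‖ with hb
  have hbJ : ENNReal.ofReal a * ENNReal.ofReal c ≤ ENNReal.ofReal b * J := by
    refine (hw.secondDifference_mul_le_setLIntegral hdet ha hX hc).trans_eq ?_
    rw [hb, ENNReal.ofReal_add (by positivity) (by positivity),
      ENNReal.ofReal_mul (by positivity), ENNReal.ofReal_mul (by positivity)]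
    simp [ofReal_norm, S, J]
  have hJQ : J ^ 2 ≤ ENNReal.ofReal (3 * a * a * (|(det₂ d v)⁻¹| * Q)) := by
    refine (sq_setLIntegral_oblique_le (measurable_gradient w).enorm hXm hdet
      fun z hz => hX _ hz.1 _ hz.2).trans_eq ?_
    have hvol : volume S = ENNReal.ofReal (3 * a) * ENNReal.ofReal a := by
      rw [Measure.volume_eq_prod, Measure.prod_prod, Real.volume_Icc, Real.volume_Icc, sub_zero,
        sub_zero]
    have hQ : ENNReal.ofReal Q = ∫⁻ x in X, ‖gradient w x‖ₑ ^ 2 := by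
      rw [ofReal_integral_eq_lintegral_ofReal hint (.of_forall fun x => by positivity)]
      simp only [ENNReal.ofReal_pow (norm_nonneg _), ofReal_norm]
    rw [hvol, ← hQ, ENNReal.ofReal_mul (p := 3 * a * a) (by positivity),
      ENNReal.ofReal_mul (p := 3 * a) (by positivity), ENNReal.ofReal_mul (abs_nonneg _)]
  have hsq : (a * c) ^ 2 ≤ b ^ 2 * (3 * a * a * (|(det₂ d v)⁻¹| * Q)) := by
    have : 0 ≤ Q := integral_nonneg fun x => by positivity
    rw [← ENNReal.ofReal_le_ofReal_iff (by positivity), ENNReal.ofReal_pow (by positivity),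
      ENNReal.ofReal_mul ha.le, ENNReal.ofReal_mul (by positivity),
      ENNReal.ofReal_pow (by positivity)]
    calc _ ≤ (ENNReal.ofReal b * J) ^ 2 := by gcongr
      _ ≤ _ := by
        rw [mul_pow]
        gcongr
  refine le_of_mul_le_mul_left ?_ (pow_pos ha 2)
  rw [← mul_pow]
  refine hsq.trans_eq ?_
  rw [abs_inv]
  ring

end Parallelogram

section LipschitzDomain

variable {Ω : Set Plane}

theorem le_of_mem_closure_of_graph {R : Plane ≃ₗᵢ[ℝ] Plane} {φ : ℝ → ℝ} (hφ : Continuous φ)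
    {x : Plane} {r : ℝ} (hgraph : ∀ y ∈ Metric.ball x r, (y ∈ Ω ↔ φ (R y 0) < R y 1))
    {y : Plane} (hy : y ∈ closure Ω) (hyx : y ∈ Metric.ball x r) : φ (R y 0) ≤ R y 1 := by
  have hclosed : IsClosed {z : Plane | φ (R z 0) ≤ R z 1} :=
    isClosed_le (by fun_prop) (by fun_prop)
  refine closure_minimal ?_ hclosed (Metric.isOpen_ball.inter_closure ⟨hyx, hy⟩)
  rintro z ⟨hz, hzΩ⟩
  exact ((hgraph z hz).1 hzΩ).le

theorem volume_setOf_eq_graph (R : Plane ≃ₗᵢ[ℝ] Plane) {φ : ℝ → ℝ} (hφ : Continuous φ) :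
    volume {y : Plane | φ (R y 0) = R y 1} = 0 := by
  have hcoord : MeasurePreserving (fun y : Plane => (R y 0, R y 1)) volume volume :=
    ((volume_preserving_finTwoArrow ℝ).comp (PiLp.volume_preserving_ofLp (ι := Fin 2))).comp
      R.measurePreserving
  have hmeas : MeasurableSet {z : ℝ × ℝ | φ z.1 = z.2} :=
    (isClosed_eq (by fun_prop) (by fun_prop)).measurableSet
  change volume ((fun y : Plane => (R y 0, R y 1)) ⁻¹' {z : ℝ × ℝ | φ z.1 = z.2}) = 0
  rw [hcoord.measure_preimage hmeas.nullMeasurableSet, Measure.volume_eq_prod,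
    Measure.measure_prod_null hmeas]
  refine .of_forall fun s => ?_
  have hsection : Prod.mk s ⁻¹' {z : ℝ × ℝ | φ z.1 = z.2} = {φ s} := by
    ext t
    simp [eq_comm]
  simp [hsection]

theorem HasLipschitzBoundary.volume_frontier (hL : HasLipschitzBoundary Ω) (hΩ : IsOpen Ω) :
    volume (frontier Ω) = 0 := by
  refine measure_null_of_locally_null _ fun x hx => ?_
  obtain ⟨R, φ, M, r, hφ, hr, hgraph⟩ := hL x hx
  refine ⟨frontier Ω ∩ Metric.ball x r,
    inter_mem_nhdsWithin _ (Metric.ball_mem_nhds x hr),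
    measure_mono_null ?_ (volume_setOf_eq_graph R hφ.continuous)⟩
  rintro y ⟨hy, hyx⟩
  rw [hΩ.frontier_eq] at hy
  exact (le_of_mem_closure_of_graph hφ.continuous hgraph hy.1 hyx).antisymm
    (not_lt.1 fun hlt => hy.2 ((hgraph y hyx).2 hlt))

theorem HasLipschitzBoundary.restrict_closure (hL : HasLipschitzBoundary Ω) (hΩ : IsOpen Ω) :
    (volume : Measure Plane).restrict (closure Ω) = volume.restrict Ω := by
  refine Measure.restrict_congr_set (Filter.EventuallyLE.antisymm ?_
    (Filter.Eventually.of_forall subset_closure))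
  rw [ae_le_set, ← hΩ.frontier_eq]
  exact hL.volume_frontier hΩ

/-- The vector `v` points into `Ω` uniformly near `x`: the segments of length `r ‖v‖` in direction
`v` that start at points of `closure Ω` within distance `r` of `x` stay in `closure Ω`. -/
def IsInwardDirection (Ω : Set Plane) (x : Plane) (r : ℝ) (v : Plane) : Prop :=
  ∀ y ∈ closure Ω, dist y x < r → ∀ t ∈ Set.Icc 0 r, y + t • v ∈ closure Ω

theorem IsInwardDirection.mono {x x' v : Plane} {r r' : ℝ} (h : IsInwardDirection Ω x r v)
    (hr : r' + dist x' x ≤ r) : IsInwardDirection Ω x' r' v :=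
  fun y hy hyx t ht => h y hy (by linarith [dist_triangle y x' x]) t
    ⟨ht.1, by linarith [ht.2, dist_nonneg (x := x') (y := x)]⟩

theorem dist_add_smul_lt {x y v : Plane} {r t : ℝ} (hv : ‖v‖ ≤ 1) (hyx : dist y x < r / 2)
    (ht : t ∈ Set.Icc 0 (r / 2)) : dist (y + t • v) x < r := by
  have hmove : dist (y + t • v) y ≤ t := by
    rw [dist_self_add_left, norm_smul, Real.norm_of_nonneg ht.1]
    exact mul_le_of_le_one_right ht.1 hv
  linarith [dist_triangle (y + t • v) y x, ht.2]

theorem isInwardDirection_of_ball_subset {x v : Plane} {r : ℝ} (hr : Metric.ball x r ⊆ Ω)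
    (hv : ‖v‖ ≤ 1) : IsInwardDirection Ω x (r / 2) v :=
  fun _ _ hyx _ ht => subset_closure (hr (dist_add_smul_lt hv hyx ht))

theorem isInwardDirection_of_graph {R : Plane ≃ₗᵢ[ℝ] Plane} {φ : ℝ → ℝ} {M : NNReal}
    (hφ : LipschitzWith M φ) {x : Plane} {r : ℝ}
    (hgraph : ∀ y ∈ Metric.ball x r, (y ∈ Ω ↔ φ (R y 0) < R y 1)) {e : Plane} (he : ‖e‖ ≤ 1)
    (hMe : M * |e 0| < e 1) : IsInwardDirection Ω x (r / 2) (R.symm e) := by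
  intro y hy hyx t ht
  rcases ht.1.eq_or_lt with rfl | ht0
  · rwa [zero_smul, add_zero]
  have hmem : y + t • R.symm e ∈ Metric.ball x r :=
    dist_add_smul_lt (by rwa [LinearIsometryEquiv.norm_map]) hyx ht
  have hyr : y ∈ Metric.ball x r :=
    hyx.trans_le (by linarith [dist_nonneg.trans_lt hyx])
  refine subset_closure ((hgraph _ hmem).2 ?_)
  have hR : R (y + t • R.symm e) = R y + t • e := by simp
  simp only [hR, PiLp.add_apply, PiLp.smul_apply, smul_eq_mul]
  have hlip : |φ (R y 0 + t * e 0) - φ (R y 0)| ≤ t * (M * |e 0|) := by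
    refine (hφ.dist_le_mul _ _).trans_eq ?_
    rw [Real.dist_eq, add_sub_cancel_left, abs_mul, abs_of_pos ht0]
    ring
  linarith [(abs_le.1 hlip).2, mul_lt_mul_of_pos_left hMe ht0,
    le_of_mem_closure_of_graph hφ.continuous hgraph hy hyr]

theorem abs_det₂_map (R : Plane ≃ₗᵢ[ℝ] Plane) (d v : Plane) : |det₂ (R d) (R v)| = |det₂ d v| := by
  have hsq (d v : Plane) : det₂ d v ^ 2 = ‖d‖ ^ 2 * ‖v‖ ^ 2 - inner ℝ d v ^ 2 := by
    simp only [det₂, inner_eq_sum_coord, EuclideanSpace.norm_sq_eq, Fin.sum_univ_two,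
      Real.norm_eq_abs, sq_abs]
    ring
  rw [← sq_eq_sq_iff_abs_eq_abs, hsq, hsq, R.norm_map, R.norm_map, R.inner_map_map]

theorem HasLipschitzBoundary.exists_isInwardDirection_pair (hL : HasLipschitzBoundary Ω)
    (hΩ : IsOpen Ω) {x : Plane} (hx : x ∈ closure Ω) :
    ∃ r > 0, ∃ e e' : Plane, det₂ e e' ≠ 0 ∧ ‖e‖ ≤ 1 ∧ ‖e'‖ ≤ 1 ∧
      IsInwardDirection Ω x r e ∧ IsInwardDirection Ω x r e' := by
  by_cases hxΩ : x ∈ Ω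
  · obtain ⟨r, hr, hball⟩ := Metric.isOpen_iff.1 hΩ x hxΩ
    have h₀ : ‖(!₂[1, 0] : Plane)‖ ≤ 1 := by simp [EuclideanSpace.norm_eq]
    have h₁ : ‖(!₂[0, 1] : Plane)‖ ≤ 1 := by simp [EuclideanSpace.norm_eq]
    exact ⟨r / 2, half_pos hr, _, _, by simp [det₂], h₀, h₁,
      isInwardDirection_of_ball_subset hball h₀, isInwardDirection_of_ball_subset hball h₁⟩
  · obtain ⟨R, φ, M, r, hφ, hr, hgraph⟩ := hL x (hΩ.frontier_eq ▸ ⟨hx, hxΩ⟩)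
    set k : ℝ := (M + 2)⁻¹
    have hk : 0 < k := by positivity
    have hkM : k * (M + 2) = 1 := inv_mul_cancel₀ (by positivity)
    have h₀ : ‖(!₂[0, 1] : Plane)‖ ≤ 1 := by simp [EuclideanSpace.norm_eq]
    have h₁ : ‖(!₂[k, k * (M + 1)] : Plane)‖ ≤ 1 := by
      rw [← sq_le_one_iff₀ (norm_nonneg _), EuclideanSpace.norm_sq_eq]
      simp only [Fin.sum_univ_two, Matrix.cons_val_zero, Matrix.cons_val_one, Real.norm_eq_abs,
        sq_abs]
      nlinarith [mul_nonneg (sq_nonneg k) M.2]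
    refine ⟨r / 2, half_pos hr, R.symm !₂[0, 1], R.symm !₂[k, k * (M + 1)], ?_,
      by rwa [R.symm.norm_map], by rwa [R.symm.norm_map],
      isInwardDirection_of_graph hφ hgraph h₀ (by simp),
      isInwardDirection_of_graph hφ hgraph h₁ ?_⟩
    · rw [← abs_pos, abs_det₂_map]
      simpa [det₂] using hk.ne'
    · simp only [Matrix.cons_val_zero, Matrix.cons_val_one, abs_of_pos hk]
      linarith

theorem abs_det₂_mul_norm_le (d e e' : Plane) :
    |det₂ e e'| * ‖d‖ ≤ |det₂ d e'| * ‖e‖ + |det₂ d e| * ‖e'‖ := by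
  have hcramer : det₂ e e' • d = det₂ d e' • e - det₂ d e • e' := by
    ext i
    fin_cases i <;> simp [det₂] <;> ring
  simpa only [norm_smul, Real.norm_eq_abs, ← hcramer] using
    norm_sub_le (det₂ d e' • e) (det₂ d e • e')

theorem HasLipschitzBoundary.exists_isInwardDirection_transverse (hL : HasLipschitzBoundary Ω)
    (hΩ : IsOpen Ω) {x : Plane} (hx : x ∈ closure Ω) :
    ∃ ε > 0, ∀ d : Plane, ‖d‖ = 1 →
      ∃ v : Plane, ‖v‖ ≤ 1 ∧ ε ≤ |det₂ d v| ∧ IsInwardDirection Ω x ε v := by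
  obtain ⟨r, hr, e, e', hdet, he, he', hin, hin'⟩ := hL.exists_isInwardDirection_pair hΩ hx
  refine ⟨min r (|det₂ e e'| / 2), lt_min hr (half_pos (abs_pos.2 hdet)), fun d hd => ?_⟩
  have hmono : min r (|det₂ e e'| / 2) + dist x x ≤ r := by simp
  have hsum : |det₂ e e'| ≤ |det₂ d e'| + |det₂ d e| := by
    have := abs_det₂_mul_norm_le d e e'
    rw [hd, mul_one] at this
    exact this.trans (add_le_add (mul_le_of_le_one_right (abs_nonneg _) he)
      (mul_le_of_le_one_right (abs_nonneg _) he'))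
  by_cases hle : |det₂ e e'| / 2 ≤ |det₂ d e|
  · exact ⟨e, he, (min_le_right _ _).trans hle, hin.mono hmono⟩
  · exact ⟨e', he', (min_le_right _ _).trans (by linarith), hin'.mono hmono⟩

theorem HasLipschitzBoundary.exists_uniform_isInwardDirection (hL : HasLipschitzBoundary Ω)
    (hΩ : IsOpen Ω) (hbdd : Bornology.IsBounded Ω) :
    ∃ ε > 0, ∀ x ∈ closure Ω, ∀ d : Plane, ‖d‖ = 1 →
      ∃ v : Plane, ‖v‖ ≤ 1 ∧ ε ≤ |det₂ d v| ∧ IsInwardDirection Ω x ε v := by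
  refine hbdd.isCompact_closure.induction_on (p := fun S => ∃ ε > 0, ∀ x ∈ S, ∀ d : Plane,
    ‖d‖ = 1 → ∃ v : Plane, ‖v‖ ≤ 1 ∧ ε ≤ |det₂ d v| ∧ IsInwardDirection Ω x ε v) ?_ ?_ ?_ ?_
  · exact ⟨1, one_pos, fun x hx => absurd hx (Set.notMem_empty x)⟩
  · rintro S S' hSS ⟨ε, hε, h⟩
    exact ⟨ε, hε, fun x hx => h x (hSS hx)⟩
  · rintro S S' ⟨ε, hε, h⟩ ⟨ε', hε', h'⟩
    refine ⟨min ε ε', lt_min hε hε', ?_⟩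
    rintro x (hx | hx) d hd
    · obtain ⟨v, hv, hdet, hin⟩ := h x hx d hd
      exact ⟨v, hv, (min_le_left _ _).trans hdet, hin.mono (by simp)⟩
    · obtain ⟨v, hv, hdet, hin⟩ := h' x hx d hd
      exact ⟨v, hv, (min_le_right _ _).trans hdet, hin.mono (by simp)⟩
  · intro x hx
    obtain ⟨ε, hε, h⟩ := hL.exists_isInwardDirection_transverse hΩ hx
    refine ⟨Metric.ball x (ε / 2), mem_nhdsWithin_of_mem_nhds
      (Metric.ball_mem_nhds x (half_pos hε)), ε / 2, half_pos hε, fun z hz d hd => ?_⟩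
    obtain ⟨v, hv, hdet, hin⟩ := h d hd
    exact ⟨v, hv, (half_le_self hε.le).trans hdet, hin.mono (by linarith [Metric.mem_ball.1 hz])⟩

end LipschitzDomain

section Simplex

variable {E : Type*} [NormedAddCommGroup E] [InnerProductSpace ℝ E] [FiniteDimensional ℝ E]

theorem measure_convexHull_eq_zero_of_card_le [MeasurableSpace E] [BorelSpace E] (μ : Measure E)
    [μ.IsAddHaarMeasure] {s : Finset E} (hs : s.card ≤ Module.finrank ℝ E) :
    μ (convexHull ℝ (s : Set E)) = 0 := by
  classical
  rcases s.eq_empty_or_nonempty with rfl | hne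
  · simp
  refine measure_mono_null (convexHull_subset_affineSpan _)
    (Measure.addHaar_affineSubspace μ _ fun htop => ?_)
  have hrank := finrank_vectorSpan_image_finset_le ℝ (id : E → E) s (n := s.card - 1)
    (Nat.sub_add_cancel hne.card_pos).symm
  rw [Finset.image_id, ← direction_affineSpan, htop, AffineSubspace.direction_top,
    finrank_top] at hrank
  have := hne.card_pos
  omega

theorem exists_forall_eq_inner_add (f : E →ᵃ[ℝ] ℝ) :
    ∃ (g : E) (c : ℝ), ∀ x, f x = inner ℝ g x + c := by
  refine ⟨(InnerProductSpace.toDual ℝ E).symm (LinearMap.toContinuousLinearMap f.linear),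
    f 0, fun x => ?_⟩
  rw [InnerProductSpace.toDual_symm_apply]
  simpa using f.map_vadd 0 x

theorem exists_hyperplanes_mem_interior_convexHull [Nontrivial E] {s : Finset E}
    (hs : AffineIndependent ℝ ((↑) : s → E)) (hcard : s.card = Module.finrank ℝ E + 1) :
    ∃ Z : Set (E × ℝ), Z.Finite ∧ (∀ z ∈ Z, z.1 ≠ 0) ∧
      ∀ x ∈ convexHull ℝ (s : Set E), (∀ z ∈ Z, x ∉ hyperplane z) →
        x ∈ interior (convexHull ℝ (s : Set E)) := by
  let b : AffineBasis s ℝ E :=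
    ⟨_, hs, hs.affineSpan_eq_top_iff_card_eq_finrank_add_one.2 (by simp [hcard])⟩
  have hb : Set.range b = (s : Set E) := Subtype.range_coe
  have : Nontrivial s := by
    rw [← Fintype.one_lt_card_iff_nontrivial, Fintype.card_coe, hcard]
    exact Nat.succ_lt_succ Module.finrank_pos
  choose g c hgc using fun i => exists_forall_eq_inner_add (b.coord i)
  refine ⟨Set.range fun i => (g i, -c i), Set.finite_range _, ?_, fun x hx hxZ => ?_⟩
  · rintro _ ⟨i, rfl⟩ (hgi : g i = 0)
    obtain ⟨j, hji⟩ := exists_ne i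
    have hi := hgc i (b i)
    have hj := hgc i (b j)
    rw [b.coord_apply_eq, hgi, inner_zero_left] at hi
    rw [b.coord_apply_ne hji.symm, hgi, inner_zero_left] at hj
    linarith
  · rw [← hb, b.interior_convexHull]
    rw [← hb, b.convexHull_eq_nonneg_coord] at hx
    refine fun i => lt_of_le_of_ne (hx i) fun h => hxZ _ ⟨i, rfl⟩ (?_ : inner ℝ (g i) x = -c i)
    linarith [hgc i x]

end Simplex

section Triangulation

variable {T : Geometry.SimplicialComplex ℝ Plane} {Ω : Set Plane}

theorem card_le_three_of_mem_faces {s : Finset Plane} (hs : s ∈ T.faces) : s.card ≤ 3 := by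
  have hcard := (T.indep hs).card_le_finrank_succ
  have hrank := Submodule.finrank_le (vectorSpan ℝ (Set.range ((↑) : s → Plane)))
  rw [finrank_euclideanSpace_fin] at hrank
  rw [Fintype.card_coe] at hcard
  omega

theorem IsTriangulation.finite_elements (hT : IsTriangulation T Ω) : (elements T).Finite :=
  hT.1.subset fun _ h => h.1

theorem IsTriangulation.convexHull_subset (hT : IsTriangulation T Ω) {K : Finset Plane}
    (hK : K ∈ elements T) : convexHull ℝ (K : Set Plane) ⊆ closure Ω :=
  hT.2 ▸ Geometry.SimplicialComplex.convexHull_subset_space hK.1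

theorem IsTriangulation.closure_subset (hT : IsTriangulation T Ω) (hΩ : IsOpen Ω) :
    closure Ω ⊆ ⋃ K ∈ elements T, convexHull ℝ (K : Set Plane) := by
  have hclosed : IsClosed (⋃ K ∈ elements T, convexHull ℝ (K : Set Plane)) :=
    hT.finite_elements.isClosed_biUnion fun K _ => K.finite_toSet.isClosed_convexHull ℝ
  refine closure_minimal ?_ hclosed
  -- The part of `Ω` outside the triangles is open and covered by simplices of area zero.
  rw [← Set.sdiff_eq_empty, ← (hΩ.sdiff hclosed).measure_eq_zero_iff volume]
  refine measure_mono_null (t := ⋃ K ∈ T.faces \ elements T, convexHull ℝ (K : Set Plane)) ?_ ?_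
  · rintro x ⟨hx, hx'⟩
    obtain ⟨K, hK, hxK⟩ := Geometry.SimplicialComplex.mem_space_iff.1 (hT.2 ▸ subset_closure hx)
    exact Set.mem_biUnion ⟨hK, fun hK' => hx' (Set.mem_biUnion hK' hxK)⟩ hxK
  · refine (measure_biUnion_null_iff (hT.1.subset Set.sdiff_subset).countable).2 fun K hK =>
      measure_convexHull_eq_zero_of_card_le _ ?_
    rw [finrank_euclideanSpace_fin]
    have hle := card_le_three_of_mem_faces hK.1
    have hne : K.card ≠ 3 := fun h => hK.2 ⟨hK.1, h⟩
    omega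

theorem aedisjoint_elements {K K' : Finset Plane} (hK : K ∈ elements T) (hK' : K' ∈ elements T)
    (hne : K ≠ K') :
    AEDisjoint volume (convexHull ℝ (K : Set Plane)) (convexHull ℝ (K' : Set Plane)) := by
  classical
  refine measure_mono_null (T.inter_subset_convexHull hK.1 hK'.1) ?_
  rw [← Finset.coe_inter]
  refine measure_convexHull_eq_zero_of_card_le _ ?_
  have hssub : K ∩ K' ⊂ K := Finset.inter_subset_left.ssubset_of_ne fun h => hne
    (Finset.eq_of_subset_of_card_le (Finset.inter_eq_left.1 h) (hK'.2.trans hK.2.symm).le)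
  have := Finset.card_lt_card hssub
  rw [hK.2] at this
  rw [finrank_euclideanSpace_fin]
  omega

theorem sum_setIntegral_elements_le {F : Plane → ℝ} {S : Set Plane} (hF : IntegrableOn F S)
    (hF0 : ∀ x, 0 ≤ F x) {ι : Type*} (s : Finset ι) {k : ι → Finset Plane}
    (hk : ∀ i ∈ s, k i ∈ elements T) (hinj : Set.InjOn k s)
    (hS : ∀ i ∈ s, convexHull ℝ (k i : Set Plane) ⊆ S) :
    ∑ i ∈ s, ∫ x in convexHull ℝ (k i : Set Plane), F x ≤ ∫ x in S, F x := by
  have hsub : (⋃ i : s, convexHull ℝ (k i : Set Plane)) ⊆ S := Set.iUnion_subset fun i => hS i i.2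
  have hsum := integral_iUnion_ae (s := fun i : s => convexHull ℝ (k i : Set Plane))
    (fun i => ((k i).finite_toSet.isClosed_convexHull ℝ).measurableSet.nullMeasurableSet)
    (fun i j hij => aedisjoint_elements (hk i i.2) (hk j j.2)
      fun h => hij (Subtype.ext (hinj i.2 j.2 h))) (hF.mono_set hsub)
  rw [tsum_fintype, Finset.univ_eq_attach,
    Finset.sum_attach s fun i => ∫ x in convexHull ℝ (k i : Set Plane), F x] at hsum
  rw [← hsum]
  exact setIntegral_mono_set hF (.of_forall hF0) (.of_forall hsub)

end Triangulation

section AffineGradient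

variable {E : Type*} [NormedAddCommGroup E] [InnerProductSpace ℝ E] [CompleteSpace E]

theorem hasGradientAt_of_sub_eq_inner {w : E → ℝ} {S : Set E} {g : E}
    (hw : ∀ x ∈ S, ∀ y ∈ S, w x - w y = inner ℝ g (x - y)) {x : E} (hx : x ∈ interior S) :
    HasGradientAt w g x := by
  have haff : HasGradientAt (fun y => w x + inner ℝ g (y - x)) g x := by
    rw [hasGradientAt_iff_hasFDerivAt]
    exact ((innerSL ℝ g).hasFDerivAt.comp x ((hasFDerivAt_id x).sub_const x)).const_add _
  refine haff.congr_of_eventuallyEq ?_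
  filter_upwards [isOpen_interior.mem_nhds hx] with y hy
  linarith [hw y (interior_subset hy) x (interior_subset hx)]

theorem hasGradientAt_norm_sq (x : E) : HasGradientAt (fun y => ‖y‖ ^ 2) ((2 : ℝ) • x) x := by
  rw [hasGradientAt_iff_hasFDerivAt]
  have hdual : InnerProductSpace.toDual ℝ E ((2 : ℝ) • x) = 2 • innerSL ℝ x := by
    ext y
    simp
  rw [hdual]
  exact (hasStrictFDerivAt_norm_sq x).hasFDerivAt

end AffineGradient

section Error

variable {T : Geometry.SimplicialComplex ℝ Plane} {Ω : Set Plane} {U : Plane → ℝ}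
  {g : Finset Plane → Plane} {K : Finset Plane}

/-- The error `u - U` in approximating the quadratic function `u` by `U`. -/
def error (U : Plane → ℝ) : Plane → ℝ := fun x => quadratic x - U x

/-- `g K` is the constant gradient of the piecewise linear function `U` on the element `K`. -/
def IsElementGradient (T : Geometry.SimplicialComplex ℝ Plane) (U : Plane → ℝ)
    (g : Finset Plane → Plane) : Prop :=
  ∀ K ∈ elements T, ∀ x ∈ convexHull ℝ (K : Set Plane), ∀ y ∈ convexHull ℝ (K : Set Plane),
    U x - U y = inner ℝ (g K) (x - y)

theorem exists_isElementGradient (hU : U ∈ piecewiseLinear T) : ∃ g, IsElementGradient T U g := by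
  choose! f hf using hU.2
  choose g c hgc using fun K => exists_forall_eq_inner_add (f K)
  refine ⟨g, fun K hK x hx y hy => ?_⟩
  rw [hf K hK hx, hf K hK hy, hgc, hgc, inner_sub_right]
  ring

theorem quadratic_eq_norm_sq : quadratic = fun x => ‖x‖ ^ 2 := by
  ext x
  simp [quadratic, EuclideanSpace.norm_sq_eq, Fin.sum_univ_two]

theorem IsElementGradient.hasGradientAt_error (hg : IsElementGradient T U g)
    (hK : K ∈ elements T) {x : Plane} (hx : x ∈ interior (convexHull ℝ (K : Set Plane))) :
    HasGradientAt (error U) ((2 : ℝ) • x - g K) x := by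
  have hquad := hasGradientAt_norm_sq x
  have hlin := hasGradientAt_of_sub_eq_inner (hg K hK) hx
  rw [hasGradientAt_iff_hasFDerivAt] at hquad hlin ⊢
  have hsub := hquad.sub hlin
  rw [← map_sub, ← quadratic_eq_norm_sq] at hsub
  exact hsub

theorem IsElementGradient.gradient_error_ae_eq (hg : IsElementGradient T U g)
    (hK : K ∈ elements T) :
    gradient (error U) =ᵐ[volume.restrict (convexHull ℝ (K : Set Plane))]
      fun x => (2 : ℝ) • x - g K := by
  have hinterior := interior_ae_eq_of_null_frontier
    ((convex_convexHull ℝ (K : Set Plane)).addHaar_frontier volume)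
  rw [← Measure.restrict_congr_set hinterior]
  filter_upwards [ae_restrict_mem isOpen_interior.measurableSet] with x hx
  exact (hg.hasGradientAt_error hK hx).gradient

theorem IsTriangulation.exists_isPiecewiseSmooth_error (hT : IsTriangulation T Ω)
    (hΩ : IsOpen Ω) (hU : U ∈ piecewiseLinear T) :
    ∃ Z, IsPiecewiseSmooth Z (closure Ω) (error U) := by
  obtain ⟨g, hg⟩ := exists_isElementGradient hU
  choose! Z hZfin hZ0 hZ using fun K (hK : K ∈ elements T) =>
    exists_hyperplanes_mem_interior_convexHull (T.indep hK.1) (by simp [hK.2])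
  refine ⟨⋃ K ∈ elements T, Z K, hT.finite_elements.biUnion hZfin, ?_, ?_, fun x hx hxZ => ?_⟩
  · intro z hz
    obtain ⟨K, hK, hzK⟩ := Set.mem_iUnion₂.1 hz
    exact hZ0 K hK z hzK
  · have hcont : Continuous quadratic := by
      rw [quadratic_eq_norm_sq]
      fun_prop
    exact hcont.continuousOn.sub (hT.2 ▸ hU.1)
  · obtain ⟨K, hK, hxK⟩ := Set.mem_iUnion₂.1 (hT.closure_subset hΩ hx)
    exact (hg.hasGradientAt_error hK
      (hZ K hK x hxK fun z hz => hxZ z (Set.mem_biUnion hK hz))).differentiableAt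

theorem IsTriangulation.integrableOn_gradient_error_sq (hT : IsTriangulation T Ω)
    (hΩ : IsOpen Ω) (hU : U ∈ piecewiseLinear T) :
    IntegrableOn (fun x => ‖gradient (error U) x‖ ^ 2) (closure Ω) := by
  obtain ⟨g, hg⟩ := exists_isElementGradient hU
  refine IntegrableOn.mono_set ?_ (hT.closure_subset hΩ)
  refine (integrableOn_finite_biUnion hT.finite_elements).2 fun K hK => ?_
  have hcont : Continuous fun x : Plane => ‖(2 : ℝ) • x - g K‖ ^ 2 := by fun_prop
  refine (hcont.continuousOn.integrableOn_compact
    (K.finite_toSet.isCompact_convexHull ℝ)).congr_fun_ae ?_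
  filter_upwards [hg.gradient_error_ae_eq hK] with x hx
  rw [hx]

theorem IsElementGradient.volume_mul_norm_sub_sq_le (hg : IsElementGradient T U g)
    (hK : K ∈ elements T)
    (hint : IntegrableOn (fun x => ‖gradient (error U) x‖ ^ 2) (convexHull ℝ (K : Set Plane)))
    {P : Plane} (hP : P ∈ K) {δ : ℝ} (hδ : Metric.diam (convexHull ℝ (K : Set Plane)) ≤ δ) :
    volume.real (convexHull ℝ (K : Set Plane)) * ‖g K - (2 : ℝ) • P‖ ^ 2 ≤
      ∫ x in convexHull ℝ (K : Set Plane), (2 * ‖gradient (error U) x‖ ^ 2 + 8 * δ ^ 2) := by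
  have hcompact := K.finite_toSet.isCompact_convexHull ℝ
  have hPK : P ∈ convexHull ℝ (K : Set Plane) := subset_convexHull ℝ _ hP
  have hconst : ∀ c : ℝ, IntegrableOn (fun _ => c) (convexHull ℝ (K : Set Plane)) := fun _ =>
    integrableOn_const hcompact.measure_lt_top.ne
  rw [← smul_eq_mul, ← setIntegral_const]
  refine integral_mono_ae (hconst _) ((hint.const_mul 2).add (hconst _)) ?_
  filter_upwards [ae_restrict_mem hcompact.measurableSet, hg.gradient_error_ae_eq hK]
    with x hx hgrad
  rw [hgrad]
  have hdist : ‖x - P‖ ≤ δ := by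
    rw [← dist_eq_norm]
    exact (Metric.dist_le_diam_of_mem hcompact.isBounded hx hPK).trans hδ
  have htri : ‖g K - (2 : ℝ) • P‖ ≤ ‖(2 : ℝ) • x - g K‖ + 2 * δ := by
    calc ‖g K - (2 : ℝ) • P‖ = ‖(2 : ℝ) • (x - P) - ((2 : ℝ) • x - g K)‖ := by
          congr 1; module
      _ ≤ ‖(2 : ℝ) • (x - P)‖ + ‖(2 : ℝ) • x - g K‖ := norm_sub_le _ _
      _ = 2 * ‖x - P‖ + ‖(2 : ℝ) • x - g K‖ := by rw [norm_smul, Real.norm_ofNat]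
      _ ≤ _ := by linarith
  have hsq := pow_le_pow_left₀ (norm_nonneg _) htri 2
  nlinarith [sq_nonneg (‖(2 : ℝ) • x - g K‖ - 2 * δ)]

theorem IsElementGradient.sum_volume_mul_norm_sub_sq_le (hg : IsElementGradient T U g)
    {S : Set Plane} (hS : volume S ≠ ⊤)
    (hint : IntegrableOn (fun x => ‖gradient (error U) x‖ ^ 2) S) {ι : Type*} (s : Finset ι)
    {k : ι → Finset Plane} (hk : ∀ i ∈ s, k i ∈ elements T) (hinj : Set.InjOn k s)
    (hkS : ∀ i ∈ s, convexHull ℝ (k i : Set Plane) ⊆ S) {δ : ℝ}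
    (hδ : ∀ i ∈ s, Metric.diam (convexHull ℝ (k i : Set Plane)) ≤ δ) {P : ι → Plane}
    (hP : ∀ i ∈ s, P i ∈ k i) :
    ∑ i ∈ s, volume.real (convexHull ℝ (k i : Set Plane)) * ‖g (k i) - (2 : ℝ) • P i‖ ^ 2 ≤
      2 * (∫ x in S, ‖gradient (error U) x‖ ^ 2) + 8 * δ ^ 2 * volume.real S := by
  calc _ ≤ ∑ i ∈ s, ∫ x in convexHull ℝ (k i : Set Plane),
        (2 * ‖gradient (error U) x‖ ^ 2 + 8 * δ ^ 2) :=
        Finset.sum_le_sum fun i hi => hg.volume_mul_norm_sub_sq_le (hk i hi)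
          (hint.mono_set (hkS i hi)) (hP i hi) (hδ i hi)
    _ ≤ ∫ x in S, (2 * ‖gradient (error U) x‖ ^ 2 + 8 * δ ^ 2) :=
        sum_setIntegral_elements_le ((hint.const_mul 2).add (integrableOn_const hS))
          (fun x => add_nonneg (by positivity) (by positivity)) s hk hinj hkS
    _ = _ := by
        rw [integral_add (hint.const_mul 2) (integrableOn_const hS), integral_const_mul,
          setIntegral_const, smul_eq_mul, mul_comm (volume.real S)]

end Error

section Angle

variable {V : Type*} [NormedAddCommGroup V] [InnerProductSpace ℝ V]

theorem abs_inner_sub_le_of_inner_eq_zero {d e e' g₀ g₁ g : V} (he : e ≠ 0) (he' : e' ≠ 0)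
    (h₀ : inner ℝ (g - g₀) e = 0) (h₁ : inner ℝ (g - g₁) e' = 0) :
    |inner ℝ (g₀ - g₁) d| ≤ (Real.sin (InnerProductGeometry.angle e e') * ‖g - g₁‖ +
      Real.sin (InnerProductGeometry.angle d e) * ‖g₀ - g₁‖) * ‖d‖ := by
  have hedge : |inner ℝ (g₀ - g₁) e| ≤
      Real.sin (InnerProductGeometry.angle e e') * ‖g - g₁‖ * ‖e‖ := by
    have heq : inner ℝ (g₀ - g₁) e = inner ℝ (g - g₁) e := by
      simp only [inner_sub_left] at h₀ ⊢
      linarith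
    have hle := abs_inner_mul_norm_le (g - g₁) e e'
    rw [h₁, abs_zero, zero_mul, zero_add] at hle
    rw [heq]
    refine le_of_mul_le_mul_right (hle.trans_eq ?_) (norm_pos_iff.2 he')
    ring
  refine le_of_mul_le_mul_right ((abs_inner_mul_norm_le (g₀ - g₁) d e).trans ?_)
    (norm_pos_iff.2 he)
  linarith [mul_le_mul_of_nonneg_right hedge (norm_nonneg d)]

theorem sin_angle_nonneg {P : Type*} [MetricSpace P] [NormedAddTorsor V P] (a b c : P) :
    0 ≤ Real.sin (EuclideanGeometry.angle a b c) :=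
  Real.sin_nonneg_of_nonneg_of_le_pi (EuclideanGeometry.angle_nonneg _ _ _)
    (EuclideanGeometry.angle_le_pi _ _ _)

theorem sin_angle_le_sin_angle {P : Type*} [MetricSpace P] [NormedAddTorsor V P] {a b c : P}
    (hab : a ≠ b) (h : EuclideanGeometry.angle a c b ≤ EuclideanGeometry.angle a b c) :
    Real.sin (EuclideanGeometry.angle a c b) ≤ Real.sin (EuclideanGeometry.angle a b c) := by
  have hsum := EuclideanGeometry.angle_add_angle_add_angle_eq_pi (p₁ := a) (p₂ := b) c hab.symm
  rw [EuclideanGeometry.angle_comm b c a] at hsum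
  have h₁ := EuclideanGeometry.angle_nonneg c a b
  have h₂ := EuclideanGeometry.angle_nonneg a c b
  rw [← sub_nonneg, Real.sin_sub_sin]
  refine mul_nonneg (mul_nonneg zero_le_two (Real.sin_nonneg_of_nonneg_of_le_pi ?_ ?_))
    (Real.cos_nonneg_of_neg_pi_div_two_le_of_le ?_ ?_) <;> linarith [Real.pi_pos]

end Angle

section Element

variable {T : Geometry.SimplicialComplex ℝ Plane} {U : Plane → ℝ} {g : Finset Plane → Plane}

theorem IsElement.not_collinear {a b c : Plane} (h : IsElement T a b c) :
    ¬ Collinear ℝ ({a, b, c} : Set Plane) := by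
  obtain ⟨K, hK, hKe⟩ := h
  have hrank := (T.indep hK.1).finrank_vectorSpan (n := 2) (by simp [hK.2])
  have hrange : Set.range ((↑) : K → Plane) = {a, b, c} := Subtype.range_coe.trans hKe
  rw [← hrange, collinear_iff_finrank_le_one, hrank]
  norm_num

theorem IsElementGradient.inner_sub_eq_zero (hg : IsElementGradient T U g) {K K' : Finset Plane}
    (hK : K ∈ elements T) (hK' : K' ∈ elements T) {x y : Plane}
    (hx : x ∈ K ∧ x ∈ K') (hy : y ∈ K ∧ y ∈ K') : inner ℝ (g K - g K') (x - y) = 0 := by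
  rw [inner_sub_left, sub_eq_zero,
    ← hg K hK x (subset_convexHull ℝ _ hx.1) y (subset_convexHull ℝ _ hy.1),
    ← hg K' hK' x (subset_convexHull ℝ _ hx.2) y (subset_convexHull ℝ _ hy.2)]

end Element

namespace StraightBand

variable {T : Geometry.SimplicialComplex ℝ Plane} {Ω : Set Plane} {U : Plane → ℝ}
  {g : Finset Plane → Plane} (B : StraightBand T)

open scoped Classical in
/-- The vertex set of the element `K_i` of the band. -/
noncomputable def lowerElement (i : ℕ) : Finset Plane := {B.base i, B.apex i, B.base (i + 1)}

open scoped Classical in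
/-- The vertex set of the element `K̃_i` of the band, `1 ≤ i ≤ N`. -/
noncomputable def upperElement (i : ℕ) : Finset Plane := {B.apex (i - 1), B.base i, B.apex i}

theorem coe_lowerElement (i : ℕ) :
    (B.lowerElement i : Set Plane) = {B.base i, B.apex i, B.base (i + 1)} := by
  simp [lowerElement]

theorem coe_upperElement (i : ℕ) :
    (B.upperElement i : Set Plane) = {B.apex (i - 1), B.base i, B.apex i} := by
  simp [upperElement]

theorem convexHull_lowerElement (i : ℕ) :
    convexHull ℝ (B.lowerElement i : Set Plane) = B.K i := by
  rw [coe_lowerElement]; rfl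

theorem convexHull_upperElement (i : ℕ) :
    convexHull ℝ (B.upperElement i : Set Plane) = B.Kt i := by
  rw [coe_upperElement]; rfl

theorem lowerElement_mem {i : ℕ} (hi : i ≤ B.N) : B.lowerElement i ∈ elements T := by
  obtain ⟨K, hK, hKe⟩ := B.elem i hi
  rwa [← Finset.coe_injective (hKe.trans (B.coe_lowerElement i).symm)]

theorem upperElement_mem {j : ℕ} (hj : j < B.N) : B.upperElement (j + 1) ∈ elements T := by
  obtain ⟨K, hK, hKe⟩ := B.elem_tilde (j + 1) (by omega) hj
  rwa [← Finset.coe_injective (hKe.trans (B.coe_upperElement (j + 1)).symm)]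

theorem strictMonoOn_pos : StrictMonoOn B.pos (Set.Iic (B.N + 1)) :=
  strictMonoOn_of_lt_succ Set.ordConnected_Iic fun i _ _ hi =>
    B.pos_lt i (Nat.le_of_succ_le_succ hi)

theorem injOn_base : Set.InjOn B.base (Set.Iic (B.N + 1)) := by
  have hdir : B.dir ≠ 0 := norm_ne_zero_iff.1 (by simp [B.norm_dir])
  exact fun i hi j hj h =>
    B.strictMonoOn_pos.injOn hi hj (smul_left_injective ℝ hdir (add_left_cancel h))

theorem apex_ne_base {i : ℕ} (hi : i ≤ B.N) (j : ℕ) : B.apex i ≠ B.base j := by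
  intro h
  refine (B.elem i hi).not_collinear
    ((collinear_iff_exists_forall_eq_smul_vadd _).2 ⟨B.start, B.dir, ?_⟩)
  rintro p (rfl | rfl | rfl)
  · exact ⟨_, add_comm _ _⟩
  · exact ⟨_, h.trans (add_comm _ _)⟩
  · exact ⟨_, add_comm _ _⟩

theorem base_mem_lowerElement_iff {i j : ℕ} (hi : i ≤ B.N + 1) (hj : j ≤ B.N) :
    B.base i ∈ B.lowerElement j ↔ i = j ∨ i = j + 1 := by
  rw [← Finset.mem_coe, coe_lowerElement]
  constructor
  · rintro (h | h | h)
    · exact .inl (B.injOn_base hi (Set.mem_Iic.2 (by omega)) h)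
    · exact absurd h.symm (B.apex_ne_base hj i)
    · exact .inr (B.injOn_base hi (Set.mem_Iic.2 (by omega)) h)
  · rintro (rfl | rfl) <;> simp

theorem injOn_lowerElement : Set.InjOn B.lowerElement (Set.Iic B.N) := by
  intro i (hi : i ≤ B.N) j (hj : j ≤ B.N) hij
  have hleft := (B.base_mem_lowerElement_iff (by omega) hj).1
    (hij ▸ (B.base_mem_lowerElement_iff (by omega) hi).2 (.inl rfl))
  have hright := (B.base_mem_lowerElement_iff (by omega) hj).1
    (hij ▸ (B.base_mem_lowerElement_iff (by omega) hi).2 (.inr rfl))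
  omega

theorem injOn_upperElement : Set.InjOn (fun j => B.upperElement (j + 1)) (Set.Iio B.N) := by
  intro i (hi : i < B.N) j (hj : j < B.N) (hij : B.upperElement (i + 1) = B.upperElement (j + 1))
  have hmem : B.base (i + 1) ∈ (B.upperElement (j + 1) : Set Plane) := by
    rw [← hij, coe_upperElement]
    simp
  rw [coe_upperElement] at hmem
  rcases hmem with h | h | h
  · exact absurd h.symm (B.apex_ne_base hj.le _)
  · exact Nat.succ_injective
      (B.injOn_base (Set.mem_Iic.2 (by omega)) (Set.mem_Iic.2 (by omega)) h)
  · exact absurd h.symm (B.apex_ne_base hj _)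

theorem convexHull_lowerElement_subset_region {i : ℕ} (hi : i ≤ B.N) :
    convexHull ℝ (B.lowerElement i : Set Plane) ⊆ B.region := by
  rw [convexHull_lowerElement]
  exact (Set.subset_biUnion_of_mem (u := B.K) (Set.mem_Icc.2 ⟨i.zero_le, hi⟩)).trans
    Set.subset_union_left

theorem convexHull_upperElement_subset_region {j : ℕ} (hj : j < B.N) :
    convexHull ℝ (B.upperElement (j + 1) : Set Plane) ⊆ B.region := by
  rw [convexHull_upperElement]
  exact (Set.subset_biUnion_of_mem (u := B.Kt) (Set.mem_Icc.2 ⟨j.succ_pos, hj⟩)).trans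
    Set.subset_union_right

theorem region_subset_closure (hT : IsTriangulation T Ω) : B.region ⊆ closure Ω := by
  refine Set.union_subset (Set.iUnion₂_subset fun i hi => ?_) (Set.iUnion₂_subset fun i hi => ?_)
  · rw [← convexHull_lowerElement]
    exact hT.convexHull_subset (B.lowerElement_mem hi.2)
  · obtain ⟨j, rfl⟩ := Nat.exists_eq_add_of_le' hi.1
    rw [← convexHull_upperElement]
    exact hT.convexHull_subset (B.upperElement_mem hi.2)

theorem line_mem_lowerElement {i : ℕ} {s : ℝ} (hs : s ∈ Set.Icc (B.pos i) (B.pos (i + 1))) :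
    B.start + s • B.dir ∈ convexHull ℝ (B.lowerElement i : Set Plane) := by
  have hsegment : B.start + s • B.dir ∈ segment ℝ (B.base i) (B.base (i + 1)) := by
    obtain ⟨a, b, ha, hb, hab, rfl⟩ := Icc_subset_segment hs
    refine ⟨a, b, ha, hb, hab, ?_⟩
    rw [← eq_sub_iff_add_eq'] at hab
    simp only [base, hab, smul_eq_mul]
    module
  rw [coe_lowerElement]
  exact segment_subset_convexHull (by simp) (by simp) hsegment

theorem sin_angle_dir_le {j : ℕ} (hj : j ≤ B.N) :
    Real.sin (InnerProductGeometry.angle B.dir (B.apex j - B.base (j + 1))) ≤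
      Real.sin (Real.pi - B.angleK j) := by
  have hbase : B.base j - B.base (j + 1) = (B.pos j - B.pos (j + 1)) • B.dir := by
    simp only [base]
    module
  have hangle : EuclideanGeometry.angle (B.base j) (B.base (j + 1)) (B.apex j) =
      Real.pi - InnerProductGeometry.angle B.dir (B.apex j - B.base (j + 1)) := by
    rw [EuclideanGeometry.angle, vsub_eq_sub, vsub_eq_sub, hbase,
      InnerProductGeometry.angle_smul_left_of_neg _ _ (sub_neg.2 (B.pos_lt j hj)),
      InnerProductGeometry.angle_neg_left]
  have hmax : B.angleK j = EuclideanGeometry.angle (B.base j) (B.apex j) (B.base (j + 1)) :=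
    B.maxAngle_elem j hj
  rw [Real.sin_pi_sub, hmax, ← Real.sin_pi_sub, ← hangle]
  refine sin_angle_le_sin_angle (B.apex_ne_base hj j).symm ?_
  rw [← hmax]
  exact (le_max_right _ _).trans (le_max_right _ _)

theorem sin_angleKt {j : ℕ} (hj : j < B.N) : Real.sin (Real.pi - B.angleKt (j + 1)) =
    Real.sin (EuclideanGeometry.angle (B.apex j) (B.base (j + 1)) (B.apex (j + 1))) := by
  rw [Real.sin_pi_sub]
  exact congrArg Real.sin (B.maxAngle_elem_tilde (j + 1) (by omega) hj)

theorem abs_slope_sub_le (hg : IsElementGradient T U g) {j : ℕ} (hj : j < B.N) :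
    |inner ℝ (g (B.lowerElement j) - g (B.lowerElement (j + 1))) B.dir| ≤
      Real.sin (Real.pi - B.angleKt (j + 1)) *
          ‖g (B.upperElement (j + 1)) - g (B.lowerElement (j + 1))‖ +
        Real.sin (Real.pi - B.angleK j) *
          ‖g (B.lowerElement j) - g (B.lowerElement (j + 1))‖ := by
  have hup := B.upperElement_mem hj
  have h₀ := hg.inner_sub_eq_zero hup (B.lowerElement_mem hj.le) (x := B.apex j)
    (y := B.base (j + 1)) (by simp [upperElement, lowerElement])
    (by simp [upperElement, lowerElement])
  have h₁ := hg.inner_sub_eq_zero hup (B.lowerElement_mem hj) (x := B.apex (j + 1))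
    (y := B.base (j + 1)) (by simp [upperElement, lowerElement])
    (by simp [upperElement, lowerElement])
  have hjump := abs_inner_sub_le_of_inner_eq_zero (d := B.dir)
    (sub_ne_zero.2 (B.apex_ne_base hj.le _)) (sub_ne_zero.2 (B.apex_ne_base hj _)) h₀ h₁
  rw [B.norm_dir, mul_one] at hjump
  rw [B.sin_angleKt hj]
  exact hjump.trans (add_le_add_right
    (mul_le_mul_of_nonneg_right (B.sin_angle_dir_le hj.le) (norm_nonneg _)) _)

end StraightBand

section SlopeOscillation

variable {Ω : Set Plane} {U : Plane → ℝ}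

theorem sq_le_secondDifference_error {p d : Plane} (hd : ‖d‖ = 1) {m M a s : ℝ} (ha : 0 ≤ a)
    (hlow : m * a ≤ U (p + (s + a) • d) - U (p + s • d))
    (hup : U (p + (s + 2 * a) • d) - U (p + (s + a) • d) ≤ M * a) (hMm : M - m ≤ a) :
    a ^ 2 ≤ error U (p + (s + 2 * a) • d) - 2 * error U (p + (s + a) • d) +
      error U (p + s • d) := by
  have hquad : ∀ σ : ℝ, quadratic (p + σ • d) = ‖p‖ ^ 2 + 2 * σ * inner ℝ p d + σ ^ 2 := by
    intro σ
    simp only [quadratic_eq_norm_sq]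
    rw [norm_add_sq_real, inner_smul_right, norm_smul, hd,
      Real.norm_eq_abs, mul_one, sq_abs]
    ring
  have hprod : (M - m) * a ≤ a * a := mul_le_mul_of_nonneg_right hMm ha
  simp only [error, hquad]
  linarith

theorem sq_le_abs_secondDifference_error {p d : Plane} (hd : ‖d‖ = 1) {m M a ℓ s : ℝ}
    (hlow : MonotoneOn (fun s => U (p + s • d) - m * s) (Set.Icc 0 ℓ))
    (hup : MonotoneOn (fun s => M * s - U (p + s • d)) (Set.Icc 0 ℓ)) (hMm : M - m ≤ a)
    (ha : 0 ≤ a) (hs : 0 ≤ s) (hsℓ : s + 2 * a ≤ ℓ) :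
    a ^ 2 ≤ |error U (p + (s + 2 * a) • d) - 2 * error U (p + (s + a) • d) +
      error U (p + s • d)| := by
  have hmem : s ∈ Set.Icc 0 ℓ := ⟨hs, by linarith⟩
  have hmem_mid : s + a ∈ Set.Icc 0 ℓ := ⟨by linarith, by linarith⟩
  have hfirst := hlow hmem hmem_mid (by linarith)
  have hlast := hup hmem_mid ⟨by linarith, hsℓ⟩ (by linarith : s + a ≤ s + 2 * a)
  refine (sq_le_secondDifference_error hd ha (m := m) (M := M) ?_ ?_ hMm).trans (le_abs_self _)
  · linarith
  · linarith

theorem IsPiecewiseSmooth.pow_four_le_integral {Z : Set (Plane × ℝ)}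
    (hw : IsPiecewiseSmooth Z (closure Ω) (error U))
    (hint : IntegrableOn (fun x => ‖gradient (error U) x‖ ^ 2) (closure Ω)) {p d v : Plane}
    {ε ℓ a m M : ℝ} (hε : 0 < ε) (hd : ‖d‖ = 1) (hv : ‖v‖ ≤ 1) (hdet : ε ≤ |det₂ d v|)
    (hinward : IsInwardDirection Ω p ε v) (hmem : ∀ s ∈ Set.Icc 0 ℓ, p + s • d ∈ closure Ω)
    (hlow : MonotoneOn (fun s => U (p + s • d) - m * s) (Set.Icc 0 ℓ))
    (hup : MonotoneOn (fun s => M * s - U (p + s • d)) (Set.Icc 0 ℓ)) (hMm : M - m ≤ a)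
    (ha : 0 < a) (haℓ : 3 * a ≤ ℓ) (haε : 3 * a < ε) :
    a ^ 4 ≤ 108 / ε * ∫ x in closure Ω, ‖gradient (error U) x‖ ^ 2 := by
  have hdist : ∀ s ∈ Set.Icc 0 (3 * a), dist (p + s • d) p < ε := fun s hs => by
    rw [dist_self_add_left, norm_smul, hd, mul_one, Real.norm_of_nonneg hs.1]
    exact hs.2.trans_lt haε
  have hmain := hw.sq_secondDifference_le isClosed_closure.measurableSet hint
    (abs_pos.1 (hε.trans_le hdet)) ha (sq_nonneg a)
    (fun s hs t ht => hinward _ (hmem s ⟨hs.1, hs.2.trans haℓ⟩) (hdist s hs) t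
      ⟨ht.1, by linarith [ht.2]⟩)
    (fun s hs => sq_le_abs_secondDifference_error hd hlow hup hMm ha.le hs.1
      (by linarith [hs.2]))
  have hI : 0 ≤ ∫ x in closure Ω, ‖gradient (error U) x‖ ^ 2 :=
    integral_nonneg fun x => by positivity
  generalize (∫ x in closure Ω, ‖gradient (error U) x‖ ^ 2) = I at hmain hI ⊢
  calc a ^ 4 = (a ^ 2) ^ 2 := by ring
    _ ≤ 3 * (2 * ‖d‖ + 4 * ‖v‖) ^ 2 / |det₂ d v| * I := hmain
    _ ≤ 3 * (2 * 1 + 4 * 1) ^ 2 / ε * I := by gcongr; exact hd.le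
    _ = 108 / ε * I := by norm_num

theorem HasLipschitzBoundary.exists_pow_five_le (hL : HasLipschitzBoundary Ω) (hΩ : IsOpen Ω)
    (hbdd : Bornology.IsBounded Ω) :
    ∃ δ > 0, ∃ C > 0, ∀ (Z : Set (Plane × ℝ)) (U : Plane → ℝ) (p d : Plane) (ℓ m M : ℝ),
      IsPiecewiseSmooth Z (closure Ω) (error U) →
      IntegrableOn (fun x => ‖gradient (error U) x‖ ^ 2) (closure Ω) →
      ‖d‖ = 1 → 0 < ℓ → (∀ s ∈ Set.Icc 0 ℓ, p + s • d ∈ closure Ω) →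
      MonotoneOn (fun s => U (p + s • d) - m * s) (Set.Icc 0 ℓ) →
      MonotoneOn (fun s => M * s - U (p + s • d)) (Set.Icc 0 ℓ) → M - m ≤ δ * ℓ →
      ℓ ^ 5 ≤ C * ∫ x in closure Ω, ‖gradient (error U) x‖ ^ 2 := by
  obtain ⟨ε, hε, hdir⟩ := hL.exists_uniform_isInwardDirection hΩ hbdd
  obtain ⟨D, hD, hdiam⟩ : ∃ D > 0, ∀ x ∈ closure Ω, ∀ y ∈ closure Ω, dist x y ≤ D :=
    ⟨Metric.diam (closure Ω) + 1, by positivity, fun x hx y hy =>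
      (Metric.dist_le_diam_of_mem hbdd.closure hx hy).trans (by linarith)⟩
  obtain ⟨δ, hδ, hδ_third, hδε⟩ : ∃ δ > 0, δ ≤ 1 / 3 ∧ δ * (4 * D) ≤ ε :=
    ⟨min (1 / 3) (ε / (4 * D)), lt_min (by norm_num) (by positivity), min_le_left _ _,
      (le_div_iff₀ (by positivity)).1 (min_le_right _ _)⟩
  refine ⟨δ, hδ, D * (108 / ε) / δ ^ 4, by positivity, ?_⟩
  intro Z U p d ℓ m M hw hint hd hℓ hmem hlow hup hMm
  have hp : p ∈ closure Ω := by simpa using hmem 0 ⟨le_rfl, hℓ.le⟩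
  have hℓD : ℓ ≤ D := by
    simpa [norm_smul, hd, abs_of_pos hℓ] using hdiam _ (hmem ℓ ⟨hℓ.le, le_rfl⟩) p hp
  obtain ⟨v, hv, hdet, hinward⟩ := hdir p hp d hd
  have hfour := hw.pow_four_le_integral hint hε hd hv hdet hinward hmem hlow hup hMm
    (mul_pos hδ hℓ) (by nlinarith) (by nlinarith)
  have hI : 0 ≤ ∫ x in closure Ω, ‖gradient (error U) x‖ ^ 2 :=
    integral_nonneg fun x => by positivity
  generalize (∫ x in closure Ω, ‖gradient (error U) x‖ ^ 2) = I at hfour hI ⊢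
  rw [div_mul_eq_mul_div, le_div_iff₀ (by positivity), mul_assoc]
  calc ℓ ^ 5 * δ ^ 4 = ℓ * (δ * ℓ) ^ 4 := by ring
    _ ≤ D * (108 / ε * I) := by gcongr

theorem monotoneOn_Icc_of_monotoneOn_Icc_succ {f : ℝ → ℝ} {x : ℕ → ℝ} {n : ℕ}
    (hx : ∀ i < n, x i ≤ x (i + 1)) (hf : ∀ i < n, MonotoneOn f (Set.Icc (x i) (x (i + 1)))) :
    MonotoneOn f (Set.Icc (x 0) (x n)) := by
  suffices h : ∀ m ≤ n, x 0 ≤ x m ∧ MonotoneOn f (Set.Icc (x 0) (x m)) from (h n le_rfl).2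
  intro m
  induction m with
  | zero => simp
  | succ m ih =>
    intro hm
    obtain ⟨hle, hmono⟩ := ih (by omega)
    have hstep := hx m hm
    refine ⟨hle.trans hstep, ?_⟩
    rw [← Set.Icc_union_Icc_eq_Icc hle hstep]
    exact hmono.union_right (hf m hm) (isGreatest_Icc hle) (isLeast_Icc hstep)

end SlopeOscillation

namespace StraightBand

variable {T : Geometry.SimplicialComplex ℝ Plane} {Ω : Set Plane} {U : Plane → ℝ}
  {g : Finset Plane → Plane} (B : StraightBand T)

/-- The slope along the edge `P_i P_{i+1}` of a piecewise linear function whose gradient on each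
element `K` is `g K`. -/
noncomputable def slope (g : Finset Plane → Plane) (i : ℕ) : ℝ :=
  inner ℝ (g (B.lowerElement i)) B.dir

theorem length_pos : 0 < B.length := by
  rw [← B.pos_zero]
  exact B.strictMonoOn_pos (Set.mem_Iic.2 (Nat.zero_le _)) Set.self_mem_Iic (Nat.succ_pos _)

theorem sub_eq_slope_mul (hg : IsElementGradient T U g) {i : ℕ} (hi : i ≤ B.N) {s s' : ℝ}
    (hs : s ∈ Set.Icc (B.pos i) (B.pos (i + 1))) (hs' : s' ∈ Set.Icc (B.pos i) (B.pos (i + 1))) :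
    U (B.start + s' • B.dir) - U (B.start + s • B.dir) = B.slope g i * (s' - s) := by
  rw [hg _ (B.lowerElement_mem hi) _ (B.line_mem_lowerElement hs') _ (B.line_mem_lowerElement hs),
    add_sub_add_left_eq_sub, ← sub_smul, inner_smul_right, mul_comm, slope]

theorem monotoneOn_line {f : ℝ → ℝ}
    (hf : ∀ i ≤ B.N, MonotoneOn f (Set.Icc (B.pos i) (B.pos (i + 1)))) :
    MonotoneOn f (Set.Icc 0 B.length) := by
  rw [← B.pos_zero]
  exact monotoneOn_Icc_of_monotoneOn_Icc_succ (fun i hi => (B.pos_lt i (by omega)).le)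
    fun i hi => hf i (by omega)

theorem monotoneOn_sub_mul (hg : IsElementGradient T U g) {m : ℝ}
    (hm : ∀ i ≤ B.N, m ≤ B.slope g i) :
    MonotoneOn (fun s => U (B.start + s • B.dir) - m * s) (Set.Icc 0 B.length) := by
  refine B.monotoneOn_line fun i hi s hs s' hs' hss' => ?_
  have hslope := mul_le_mul_of_nonneg_right (hm i hi) (sub_nonneg.2 hss')
  have heq := B.sub_eq_slope_mul hg hi hs hs'
  linarith

theorem monotoneOn_mul_sub (hg : IsElementGradient T U g) {M : ℝ}
    (hM : ∀ i ≤ B.N, B.slope g i ≤ M) :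
    MonotoneOn (fun s => M * s - U (B.start + s • B.dir)) (Set.Icc 0 B.length) := by
  refine B.monotoneOn_line fun i hi s hs s' hs' hss' => ?_
  have hslope := mul_le_mul_of_nonneg_right (hM i hi) (sub_nonneg.2 hss')
  have heq := B.sub_eq_slope_mul hg hi hs hs'
  linarith

theorem line_mem_closure (hT : IsTriangulation T Ω) {s : ℝ} (hs : s ∈ Set.Icc 0 B.length) :
    B.start + s • B.dir ∈ closure Ω := by
  set i := Nat.findGreatest (fun i => B.pos i ≤ s) B.N
  have hi : i ≤ B.N := Nat.findGreatest_le _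
  have hle : B.pos i ≤ s :=
    Nat.findGreatest_spec (P := fun i => B.pos i ≤ s) B.N.zero_le (B.pos_zero.trans_le hs.1)
  have hge : s ≤ B.pos (i + 1) := by
    rcases hi.eq_or_lt with h | h
    · exact h ▸ hs.2
    · exact le_of_not_ge
        (Nat.findGreatest_is_greatest (P := fun i => B.pos i ≤ s) i.lt_succ_self h)
  exact hT.convexHull_subset (B.lowerElement_mem hi) (B.line_mem_lowerElement ⟨hle, hge⟩)

end StraightBand

theorem h1Seminorm_sq (S : Set Plane) (w : Plane → ℝ) :
    h1Seminorm S w ^ 2 = ∫ x in S, ‖gradient w x‖ ^ 2 :=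
  Real.sq_sqrt (integral_nonneg fun _ => by positivity)

theorem h1Seminorm_mono {S S' : Set Plane} {w : Plane → ℝ}
    (hint : IntegrableOn (fun x => ‖gradient w x‖ ^ 2) S') (h : S ⊆ S') :
    h1Seminorm S w ≤ h1Seminorm S' w :=
  Real.sqrt_le_sqrt (setIntegral_mono_set hint (.of_forall fun _ => by positivity) (.of_forall h))

theorem HasLipschitzBoundary.h1Seminorm_closure {Ω : Set Plane} (hL : HasLipschitzBoundary Ω)
    (hΩ : IsOpen Ω) (w : Plane → ℝ) : h1Seminorm (closure Ω) w = h1Seminorm Ω w := by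
  rw [h1Seminorm, h1Seminorm, hL.restrict_closure hΩ]

theorem HasLipschitzBoundary.exists_length_pow_five_le {Ω : Set Plane}
    (hL : HasLipschitzBoundary Ω) (hΩ : IsOpen Ω) (hbdd : Bornology.IsBounded Ω) :
    ∃ δ > 0, ∃ C > 0, ∀ (T : Geometry.SimplicialComplex ℝ Plane) (U : Plane → ℝ)
      (g : Finset Plane → Plane) (B : StraightBand T), IsTriangulation T Ω →
      U ∈ piecewiseLinear T → IsElementGradient T U g →
      (∀ i ≤ B.N, ∀ j ≤ B.N, B.slope g i - B.slope g j ≤ δ * B.length) →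
      B.length ^ 5 ≤ C * h1Seminorm Ω (error U) ^ 2 := by
  obtain ⟨δ, hδ, C, hC, hmain⟩ := hL.exists_pow_five_le hΩ hbdd
  refine ⟨δ, hδ, C, hC, fun T U g B hT hU hg hosc => ?_⟩
  obtain ⟨Z, hZ⟩ := hT.exists_isPiecewiseSmooth_error hΩ hU
  obtain ⟨i, hi, hmax⟩ := Finset.exists_max_image (Finset.Iic B.N) (B.slope g) ⟨0, by simp⟩
  obtain ⟨j, hj, hmin⟩ := Finset.exists_min_image (Finset.Iic B.N) (B.slope g) ⟨0, by simp⟩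
  simp only [Finset.mem_Iic] at hi hj hmax hmin
  rw [← hL.h1Seminorm_closure hΩ, h1Seminorm_sq]
  exact hmain Z U B.start B.dir B.length _ _ hZ (hT.integrableOn_gradient_error_sq hΩ hU)
    B.norm_dir B.length_pos (fun s hs => B.line_mem_closure hT hs) (B.monotoneOn_sub_mul hg hmin)
    (B.monotoneOn_mul_sub hg hmax) (hosc i hi j hj)

theorem mul_sq_lt_pow_five {C C_u e h α L : ℝ} (hC : 0 < C) (hh : 0 < h) (he : 0 ≤ e)
    (heh : e ≤ C_u * h ^ α) (hL : (1 + C * C_u ^ 2) * h ^ (2 * α / 5) ≤ L) :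
    C * e ^ 2 < L ^ 5 := by
  have hpow : (h ^ (2 * α / 5)) ^ 5 = (h ^ α) ^ 2 := by
    rw [← Real.rpow_mul_natCast hh.le, ← Real.rpow_mul_natCast hh.le]
    congr 1
    push_cast
    ring
  set c := 1 + C * C_u ^ 2 with hc
  have hc1 : 1 ≤ c := le_add_of_nonneg_right (by positivity)
  calc C * e ^ 2 ≤ C * (C_u * h ^ α) ^ 2 := by gcongr
    _ = (c - 1) * (h ^ α) ^ 2 := by rw [hc]; ring
    _ < c ^ 5 * (h ^ α) ^ 2 := by
        refine mul_lt_mul_of_pos_right ?_ (pow_pos (Real.rpow_pos_of_pos hh α) 2)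
        linarith [le_self_pow₀ hc1 (n := 5) (by norm_num)]
    _ = (c * h ^ (2 * α / 5)) ^ 5 := by rw [mul_pow, hpow]
    _ ≤ L ^ 5 := by gcongr

theorem HasLipschitzBoundary.exists_slope_oscillation {Ω : Set Plane}
    (hL : HasLipschitzBoundary Ω) (hΩ : IsOpen Ω) (hbdd : Bornology.IsBounded Ω) (α C_u : ℝ) :
    ∃ C_L > 0, ∃ δ > 0, ∀ (h : ℝ) (T : Geometry.SimplicialComplex ℝ Plane) (U : Plane → ℝ)
      (g : Finset Plane → Plane) (B : StraightBand T), 0 < h → IsTriangulation T Ω →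
      U ∈ piecewiseLinear T → IsElementGradient T U g →
      h1Seminorm Ω (error U) ≤ C_u * h ^ α → C_L * h ^ (2 * α / 5) ≤ B.length →
      ∃ i ≤ B.N, ∃ j ≤ B.N, δ * B.length < B.slope g i - B.slope g j := by
  obtain ⟨δ, hδ, C, hC, hmain⟩ := hL.exists_length_pow_five_le hΩ hbdd
  refine ⟨1 + C * C_u ^ 2, by positivity, δ, hδ, fun h T U g B hh hT hU hg herr hlen => ?_⟩
  by_contra! hosc
  exact (mul_sq_lt_pow_five hC hh (Real.sqrt_nonneg _) herr hlen).not_ge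
    (hmain T U g B hT hU hg hosc)

theorem abs_sub_le_sum_range_abs_sub (t : ℕ → ℝ) {i j n : ℕ} (hi : i ≤ n) (hj : j ≤ n) :
    |t i - t j| ≤ ∑ k ∈ Finset.range n, |t k - t (k + 1)| := by
  wlog hij : i ≤ j generalizing i j
  · rw [abs_sub_comm]
    exact this hj hi (by omega)
  refine (dist_le_Ico_sum_dist t hij).trans (Finset.sum_le_sum_of_subset_of_nonneg ?_ ?_)
  · exact fun k hk => Finset.mem_range.2 ((Finset.mem_Ico.1 hk).2.trans_le hj)
  · exact fun _ _ _ => abs_nonneg _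

theorem sum_sqrt_mul_le_sqrt_card_mul_sqrt {ι : Type*} (s : Finset ι) {a : ι → ℝ} (x : ι → ℝ)
    (ha : ∀ i ∈ s, 0 ≤ a i) :
    ∑ i ∈ s, √(a i) * x i ≤ √s.card * √(∑ i ∈ s, a i * x i ^ 2) := by
  have hsq : ∑ i ∈ s, (√(a i) * x i) ^ 2 = ∑ i ∈ s, a i * x i ^ 2 :=
    Finset.sum_congr rfl fun i hi => by rw [mul_pow, Real.sq_sqrt (ha i hi)]
  simpa [hsq] using Real.sum_mul_le_sqrt_mul_sqrt s (fun _ => (1 : ℝ)) fun i => √(a i) * x i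

theorem mul_add_add_sq_le {a b c k x y z : ℝ} (hk : 1 ≤ k) (ha : 0 ≤ a) (hb : a ≤ k * b)
    (hc : a ≤ k * c) :
    a * (x + y + z) ^ 2 ≤ 3 * k * (a * x ^ 2 + b * y ^ 2 + c * z ^ 2) := by
  have hsum : (x + y + z) ^ 2 ≤ 3 * (x ^ 2 + y ^ 2 + z ^ 2) := by
    nlinarith [sq_nonneg (x - y), sq_nonneg (y - z), sq_nonneg (x - z)]
  calc a * (x + y + z) ^ 2 ≤ a * (3 * (x ^ 2 + y ^ 2 + z ^ 2)) := by gcongr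
    _ = 3 * (a * x ^ 2 + a * y ^ 2 + a * z ^ 2) := by ring
    _ ≤ 3 * (k * a * x ^ 2 + k * b * y ^ 2 + k * c * z ^ 2) := by
        gcongr
        exact le_mul_of_one_le_left ha hk
    _ = 3 * k * (a * x ^ 2 + b * y ^ 2 + c * z ^ 2) := by ring

namespace StraightBand

variable {T : Geometry.SimplicialComplex ℝ Plane} {U : Plane → ℝ} {g : Finset Plane → Plane}
  (B : StraightBand T)

theorem areaK_eq (i : ℕ) :
    B.areaK i = volume.real (convexHull ℝ (B.lowerElement i : Set Plane)) := by
  rw [convexHull_lowerElement]; rfl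

theorem areaKt_eq (i : ℕ) :
    B.areaKt i = volume.real (convexHull ℝ (B.upperElement i : Set Plane)) := by
  rw [convexHull_upperElement]; rfl

theorem areaKt_nonneg (i : ℕ) : 0 ≤ B.areaKt i := ENNReal.toReal_nonneg

theorem sin_angleKt_nonneg {j : ℕ} (hj : j < B.N) :
    0 ≤ Real.sin (Real.pi - B.angleKt (j + 1)) := by
  rw [B.sin_angleKt hj]
  exact sin_angle_nonneg _ _ _

theorem minOver_le (f : ℕ → ℝ) {j : ℕ} (hj : j < B.N) : B.minOver f ≤ f (j + 1) :=
  Finset.inf'_le _ (Finset.mem_Icc.2 ⟨j.succ_pos, hj⟩)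

theorem minOver_nonneg {f : ℕ → ℝ} (hf : ∀ j < B.N, 0 ≤ f (j + 1)) : 0 ≤ B.minOver f := by
  refine (Finset.le_inf'_iff _ _).2 fun i hi => ?_
  obtain ⟨hi₁, hiN⟩ := Finset.mem_Icc.1 hi
  obtain ⟨j, rfl⟩ := Nat.exists_eq_add_of_le' hi₁
  exact hf j hiN

theorem minOver_one_div_sin_nonneg :
    0 ≤ B.minOver (fun i => 1 / Real.sin (Real.pi - B.angleKt i)) :=
  B.minOver_nonneg fun _ hj => one_div_nonneg.2 (B.sin_angleKt_nonneg hj)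

theorem minOver_sqrt_areaKt_nonneg : 0 ≤ B.minOver (fun i => √(B.areaKt i)) :=
  B.minOver_nonneg fun _ _ => Real.sqrt_nonneg _

/-- The total deviation, over the three elements `K̃_{j+1}`, `K_j`, `K_{j+1}` of the band that
share the vertex `P_{j+1}`, of the gradients `g` of a piecewise linear function from the gradient
`2 P_{j+1}` of `quadratic` at that vertex. -/
noncomputable def gradientDefect (g : Finset Plane → Plane) (j : ℕ) : ℝ :=
  ‖g (B.upperElement (j + 1)) - (2 : ℝ) • B.base (j + 1)‖ +
    ‖g (B.lowerElement j) - (2 : ℝ) • B.base (j + 1)‖ +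
    ‖g (B.lowerElement (j + 1)) - (2 : ℝ) • B.base (j + 1)‖

theorem gradientDefect_nonneg (g : Finset Plane → Plane) (j : ℕ) : 0 ≤ B.gradientDefect g j := by
  unfold gradientDefect
  positivity

theorem abs_slope_sub_slope_le (hg : IsElementGradient T U g) {c : ℝ} (hc : 0 ≤ c) {j : ℕ}
    (hj : j < B.N)
    (hsin : Real.sin (Real.pi - B.angleK j) ≤ c * Real.sin (Real.pi - B.angleKt (j + 1))) :
    |B.slope g j - B.slope g (j + 1)| ≤
      Real.sin (Real.pi - B.angleKt (j + 1)) * ((1 + c) * B.gradientDefect g j) := by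
  have hup := dist_triangle_right (g (B.upperElement (j + 1))) (g (B.lowerElement (j + 1)))
    ((2 : ℝ) • B.base (j + 1))
  have hlow := dist_triangle_right (g (B.lowerElement j)) (g (B.lowerElement (j + 1)))
    ((2 : ℝ) • B.base (j + 1))
  simp only [dist_eq_norm] at hup hlow
  have hsin₀ := B.sin_angleKt_nonneg hj
  rw [slope, slope, ← inner_sub_left]
  calc _ ≤ _ := B.abs_slope_sub_le hg hj
    _ ≤ Real.sin (Real.pi - B.angleKt (j + 1)) * B.gradientDefect g j +
          c * Real.sin (Real.pi - B.angleKt (j + 1)) * B.gradientDefect g j := by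
        unfold gradientDefect
        gcongr
        · exact hup.trans (add_le_add_left (le_add_of_nonneg_right (norm_nonneg _)) _)
        · exact hlow.trans (add_le_add_left (le_add_of_nonneg_left (norm_nonneg _)) _)
    _ = _ := by ring

theorem minOver_mul_abs_slope_sub_slope_le (hg : IsElementGradient T U g) {c : ℝ} (hc : 0 ≤ c)
    {j : ℕ} (hj : j < B.N)
    (hsin : Real.sin (Real.pi - B.angleK j) ≤ c * Real.sin (Real.pi - B.angleKt (j + 1))) :
    B.minOver (fun i => 1 / Real.sin (Real.pi - B.angleKt i)) *
        |B.slope g j - B.slope g (j + 1)| ≤ (1 + c) * B.gradientDefect g j := by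
  refine (mul_le_mul_of_nonneg_right (B.minOver_le _ hj) (abs_nonneg _)).trans ?_
  rw [one_div_mul_eq_div]
  exact div_le_of_le_mul₀ (B.sin_angleKt_nonneg hj)
    (mul_nonneg (by positivity) (B.gradientDefect_nonneg g j))
    ((B.abs_slope_sub_slope_le hg hc hj hsin).trans_eq (mul_comm _ _))

theorem minOver_mul_minOver_mul_slope_sub_slope_le (hg : IsElementGradient T U g) {c : ℝ}
    (hc : 0 ≤ c) (hsin : ∀ j < B.N,
      Real.sin (Real.pi - B.angleK j) ≤ c * Real.sin (Real.pi - B.angleKt (j + 1)))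
    {i i' : ℕ} (hi : i ≤ B.N) (hi' : i' ≤ B.N) :
    B.minOver (fun i => 1 / Real.sin (Real.pi - B.angleKt i)) *
        B.minOver (fun i => √(B.areaKt i)) * (B.slope g i - B.slope g i') ≤
      (1 + c) * (√B.N *
        √(∑ j ∈ Finset.range B.N, B.areaKt (j + 1) * B.gradientDefect g j ^ 2)) := by
  set m₁ := B.minOver fun i => 1 / Real.sin (Real.pi - B.angleKt i)
  set m₂ := B.minOver fun i => √(B.areaKt i)
  have hm₁ : 0 ≤ m₁ := B.minOver_one_div_sin_nonneg
  have hm₂ : 0 ≤ m₂ := B.minOver_sqrt_areaKt_nonneg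
  have hjump : ∀ j ∈ Finset.range B.N, m₁ * m₂ * |B.slope g j - B.slope g (j + 1)| ≤
      (1 + c) * (√(B.areaKt (j + 1)) * B.gradientDefect g j) := fun j hj => by
    have hj := Finset.mem_range.1 hj
    calc m₁ * m₂ * |B.slope g j - B.slope g (j + 1)|
        = m₂ * (m₁ * |B.slope g j - B.slope g (j + 1)|) := by ring
      _ ≤ √(B.areaKt (j + 1)) * ((1 + c) * B.gradientDefect g j) :=
          mul_le_mul (B.minOver_le _ hj)
            (B.minOver_mul_abs_slope_sub_slope_le hg hc hj (hsin j hj)) (by positivity)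
            (Real.sqrt_nonneg _)
      _ = _ := by ring
  have hcs := sum_sqrt_mul_le_sqrt_card_mul_sqrt (Finset.range B.N)
    (a := fun j => B.areaKt (j + 1)) (B.gradientDefect g) fun _ _ => B.areaKt_nonneg _
  rw [Finset.card_range] at hcs
  calc m₁ * m₂ * (B.slope g i - B.slope g i')
      ≤ m₁ * m₂ * ∑ j ∈ Finset.range B.N, |B.slope g j - B.slope g (j + 1)| := by
        gcongr
        exact (le_abs_self _).trans (abs_sub_le_sum_range_abs_sub _ hi hi')
    _ ≤ ∑ j ∈ Finset.range B.N, (1 + c) * (√(B.areaKt (j + 1)) * B.gradientDefect g j) := by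
        rw [Finset.mul_sum]
        exact Finset.sum_le_sum hjump
    _ ≤ _ := by
        rw [← Finset.mul_sum]
        gcongr

theorem sum_areaKt_mul_gradientDefect_sq_le (hg : IsElementGradient T U g)
    (hvol : volume B.region ≠ ⊤)
    (hint : IntegrableOn (fun x => ‖gradient (error U) x‖ ^ 2) B.region) {δ : ℝ}
    (hδ : ∀ K ∈ elements T, Metric.diam (convexHull ℝ (K : Set Plane)) ≤ δ) {k : ℝ} (hk : 1 ≤ k)
    (harea : ∀ j < B.N,
      B.areaKt (j + 1) ≤ k * B.areaK j ∧ B.areaKt (j + 1) ≤ k * B.areaK (j + 1)) :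
    ∑ j ∈ Finset.range B.N, B.areaKt (j + 1) * B.gradientDefect g j ^ 2 ≤
      9 * k * (2 * (∫ x in B.region, ‖gradient (error U) x‖ ^ 2) +
        8 * δ ^ 2 * volume.real B.region) := by
  have hlt : ∀ {j}, j ∈ Finset.range B.N → j < B.N := Finset.mem_range.1
  have hup := hg.sum_volume_mul_norm_sub_sq_le hvol hint (Finset.range B.N)
    (k := fun j => B.upperElement (j + 1)) (P := fun j => B.base (j + 1))
    (fun j hj => B.upperElement_mem (hlt hj)) (B.injOn_upperElement.mono fun j hj => hlt hj)
    (fun j hj => B.convexHull_upperElement_subset_region (hlt hj))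
    (fun j hj => hδ _ (B.upperElement_mem (hlt hj))) (fun j _ => by simp [upperElement])
  have hleft := hg.sum_volume_mul_norm_sub_sq_le hvol hint (Finset.range B.N)
    (k := B.lowerElement) (P := fun j => B.base (j + 1))
    (fun j hj => B.lowerElement_mem (hlt hj).le)
    (B.injOn_lowerElement.mono fun j hj => (hlt hj).le)
    (fun j hj => B.convexHull_lowerElement_subset_region (hlt hj).le)
    (fun j hj => hδ _ (B.lowerElement_mem (hlt hj).le)) (fun j _ => by simp [lowerElement])
  have hright := hg.sum_volume_mul_norm_sub_sq_le hvol hint (Finset.range B.N)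
    (k := fun j => B.lowerElement (j + 1)) (P := fun j => B.base (j + 1))
    (fun j hj => B.lowerElement_mem (hlt hj))
    (fun i hi j hj hij => Nat.succ_injective (B.injOn_lowerElement (hlt hi) (hlt hj) hij))
    (fun j hj => B.convexHull_lowerElement_subset_region (hlt hj))
    (fun j hj => hδ _ (B.lowerElement_mem (hlt hj))) (fun j _ => by simp [lowerElement])
  simp only [← areaKt_eq, ← areaK_eq] at hup hleft hright
  have hterm := Finset.sum_le_sum fun j hj => mul_add_add_sq_le
    (x := ‖g (B.upperElement (j + 1)) - (2 : ℝ) • B.base (j + 1)‖)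
    (y := ‖g (B.lowerElement j) - (2 : ℝ) • B.base (j + 1)‖)
    (z := ‖g (B.lowerElement (j + 1)) - (2 : ℝ) • B.base (j + 1)‖)
    hk (B.areaKt_nonneg _) (harea j (hlt hj)).1 (harea j (hlt hj)).2
  rw [← Finset.mul_sum, Finset.sum_add_distrib, Finset.sum_add_distrib] at hterm
  refine hterm.trans ?_
  rw [show (9 : ℝ) * k = 3 * k * 3 by ring, mul_assoc (3 * k)]
  gcongr
  linarith

theorem sqrt_sum_areaKt_mul_gradientDefect_sq_le (hg : IsElementGradient T U g)
    (hvol : volume B.region ≠ ⊤)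
    (hint : IntegrableOn (fun x => ‖gradient (error U) x‖ ^ 2) B.region) {δ : ℝ} (hδ₀ : 0 ≤ δ)
    (hδ : ∀ K ∈ elements T, Metric.diam (convexHull ℝ (K : Set Plane)) ≤ δ) {k : ℝ} (hk : 1 ≤ k)
    (harea : ∀ j < B.N,
      B.areaKt (j + 1) ≤ k * B.areaK j ∧ B.areaKt (j + 1) ≤ k * B.areaK (j + 1)) :
    √(∑ j ∈ Finset.range B.N, B.areaKt (j + 1) * B.gradientDefect g j ^ 2) ≤
      √(18 * k) * (h1Seminorm B.region (error U) + 2 * δ * √(volume.real B.region)) := by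
  set e := h1Seminorm B.region (error U)
  set w := √(volume.real B.region)
  have he₀ : 0 ≤ e := Real.sqrt_nonneg _
  have : 0 ≤ w := Real.sqrt_nonneg _
  have hw_sq : w ^ 2 = volume.real B.region := Real.sq_sqrt measureReal_nonneg
  refine Real.sqrt_le_iff.2 ⟨by positivity, ?_⟩
  rw [mul_pow, Real.sq_sqrt (by positivity)]
  calc _ ≤ _ := B.sum_areaKt_mul_gradientDefect_sq_le hg hvol hint hδ hk harea
    _ = 18 * k * (e ^ 2 + (2 * δ * w) ^ 2) := by rw [← h1Seminorm_sq, mul_pow, hw_sq]; ring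
    _ ≤ 18 * k * (e + 2 * δ * w) ^ 2 := by
        gcongr
        exact pow_add_pow_le he₀ (by positivity) two_ne_zero

end StraightBand

theorem min_le_max_one_mul_rpow {α h D : ℝ} (hα : α ∈ Set.Icc (0 : ℝ) 1) (hh : 0 < h) :
    min h D ≤ max 1 D * h ^ α := by
  have hone : 1 ≤ max 1 D := le_max_left _ _
  rcases le_total h 1 with hle | hle
  · have hpow : h ≤ h ^ α := by simpa using Real.rpow_le_rpow_of_exponent_ge hh hle hα.2
    exact (min_le_left _ _).trans (hpow.trans (le_mul_of_one_le_left (by positivity) hone))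
  · exact (min_le_right _ _).trans ((le_max_right _ _).trans
      (le_mul_of_one_le_right (by positivity) (Real.one_le_rpow hle hα.1)))

theorem StraightBand.h1Seminorm_region_add_le {Ω : Set Plane} (hL : HasLipschitzBoundary Ω)
    (hΩ : IsOpen Ω) (hbdd : Bornology.IsBounded Ω) {T : Geometry.SimplicialComplex ℝ Plane}
    (hT : IsTriangulation T Ω) {U : Plane → ℝ} (hU : U ∈ piecewiseLinear T) (B : StraightBand T)
    {δ : ℝ} (hδ : 0 ≤ δ) :
    h1Seminorm B.region (error U) + 2 * δ * √(volume.real B.region) ≤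
      h1Seminorm Ω (error U) + 2 * δ * √(volume.real (closure Ω)) := by
  have hsub := B.region_subset_closure hT
  rw [← hL.h1Seminorm_closure hΩ]
  gcongr
  · exact h1Seminorm_mono (hT.integrableOn_gradient_error_sq hΩ hU) hsub
  · exact hbdd.closure.measure_lt_top.ne

theorem StraightBand.minOver_mul_minOver_mul_slope_sub_slope_le_h1Seminorm {Ω : Set Plane}
    (hL : HasLipschitzBoundary Ω) (hΩ : IsOpen Ω) (hbdd : Bornology.IsBounded Ω)
    {T : Geometry.SimplicialComplex ℝ Plane} (hT : IsTriangulation T Ω) {U : Plane → ℝ}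
    (hU : U ∈ piecewiseLinear T) {g : Finset Plane → Plane} (hg : IsElementGradient T U g)
    (B : StraightBand T) {δ : ℝ} (hδ₀ : 0 ≤ δ)
    (hδ : ∀ K ∈ elements T, Metric.diam (convexHull ℝ (K : Set Plane)) ≤ δ)
    {c k : ℝ} (hc : 0 ≤ c) (hk : 1 ≤ k)
    (hsin : ∀ j < B.N,
      Real.sin (Real.pi - B.angleK j) ≤ c * Real.sin (Real.pi - B.angleKt (j + 1)))
    (harea : ∀ j < B.N,
      B.areaKt (j + 1) ≤ k * B.areaK j ∧ B.areaKt (j + 1) ≤ k * B.areaK (j + 1))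
    {i i' : ℕ} (hi : i ≤ B.N) (hi' : i' ≤ B.N) :
    B.minOver (fun i => 1 / Real.sin (Real.pi - B.angleKt i)) *
        B.minOver (fun i => √(B.areaKt i)) * (B.slope g i - B.slope g i') ≤
      (1 + c) * (√B.N * (√(18 * k) *
        (h1Seminorm Ω (error U) + 2 * δ * √(volume.real (closure Ω))))) := by
  have hsub := B.region_subset_closure hT
  have hdefect := B.sqrt_sum_areaKt_mul_gradientDefect_sq_le hg
    (hbdd.closure.subset hsub).measure_lt_top.ne
    ((hT.integrableOn_gradient_error_sq hΩ hU).mono_set hsub) hδ₀ hδ hk harea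
  refine (B.minOver_mul_minOver_mul_slope_sub_slope_le hg hc hsin hi hi').trans ?_
  gcongr
  refine hdefect.trans ?_
  gcongr √(18 * k) * ?_
  exact B.h1Seminorm_region_add_le hL hΩ hbdd hT hU hδ₀

theorem HasLipschitzBoundary.exists_minOver_mul_slope_sub_slope_le {Ω : Set Plane}
    (hL : HasLipschitzBoundary Ω) (hΩ : IsOpen Ω) (hbdd : Bornology.IsBounded Ω) {α : ℝ}
    (hα : α ∈ Set.Icc (0 : ℝ) 1) (C_u C_K C_α : ℝ) :
    ∃ C₂ > 0, ∀ (h : ℝ) (T : Geometry.SimplicialComplex ℝ Plane) (U : Plane → ℝ)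
      (g : Finset Plane → Plane) (B : StraightBand T), 0 < h → IsTriangulation T Ω →
      (∀ K ∈ elements T, Metric.diam (convexHull ℝ (K : Set Plane)) ≤ h) →
      U ∈ piecewiseLinear T → IsElementGradient T U g →
      h1Seminorm Ω (error U) ≤ C_u * h ^ α →
      (∀ i ∈ Set.Icc 1 B.N, B.areaKt i ≤ C_K * B.areaK i ∧ B.areaKt i ≤ C_K * B.areaK (i - 1) ∧
        Real.sin (Real.pi - B.angleK (i - 1)) ≤ C_α * Real.sin (Real.pi - B.angleKt i)) →
      ∀ i ≤ B.N, ∀ i' ≤ B.N,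
        B.minOver (fun i => 1 / Real.sin (Real.pi - B.angleKt i)) *
          B.minOver (fun i => √(B.areaKt i)) * (B.slope g i - B.slope g i') ≤
        √B.N * (C₂ * h ^ α) := by
  set D := Metric.diam (closure Ω)
  set W := volume.real (closure Ω)
  set c := max C_α 0
  set k := max C_K 1
  have hc : 0 ≤ c := le_max_right _ _
  have hk : 1 ≤ k := le_max_right _ _
  refine ⟨(1 + c) * (√(18 * k) * (max C_u 1 + 2 * max 1 D * √W)), by positivity, ?_⟩
  intro h T U g B hh hT hdiam hU hg herr hB i hi i' hi'
  have hδ₀ : 0 ≤ min h D := le_min hh.le Metric.diam_nonneg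
  have hδ : ∀ K ∈ elements T, Metric.diam (convexHull ℝ (K : Set Plane)) ≤ min h D :=
    fun K hK => le_min (hdiam K hK) (Metric.diam_mono (hT.convexHull_subset hK) hbdd.closure)
  have harea : ∀ j < B.N,
      B.areaKt (j + 1) ≤ k * B.areaK j ∧ B.areaKt (j + 1) ≤ k * B.areaK (j + 1) := fun j hj =>
    have hj := hB (j + 1) ⟨j.succ_pos, hj⟩
    ⟨hj.2.1.trans (mul_le_mul_of_nonneg_right (le_max_left _ _) ENNReal.toReal_nonneg),
      hj.1.trans (mul_le_mul_of_nonneg_right (le_max_left _ _) ENNReal.toReal_nonneg)⟩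
  have hsin : ∀ j < B.N,
      Real.sin (Real.pi - B.angleK j) ≤ c * Real.sin (Real.pi - B.angleKt (j + 1)) :=
    fun j hj => (hB (j + 1) ⟨j.succ_pos, hj⟩).2.2.trans
      (mul_le_mul_of_nonneg_right (le_max_left _ _) (B.sin_angleKt_nonneg hj))
  have herr' : h1Seminorm Ω (error U) + 2 * min h D * √W ≤
      (max C_u 1 + 2 * max 1 D * √W) * h ^ α := by
    calc _ ≤ max C_u 1 * h ^ α + 2 * (max 1 D * h ^ α) * √W := by
          gcongr
          · exact herr.trans (by gcongr; exact le_max_left _ _)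
          · exact min_le_max_one_mul_rpow hα hh
      _ = _ := by ring
  calc _ ≤ _ := B.minOver_mul_minOver_mul_slope_sub_slope_le_h1Seminorm hL hΩ hbdd hT hU hg
          hδ₀ hδ hc hk hsin harea hi hi'
    _ ≤ (1 + c) * (√B.N * (√(18 * k) * ((max C_u 1 + 2 * max 1 D * √W) * h ^ α))) := by gcongr
    _ = _ := by ring

theorem StraightBand.mul_minOver_mul_minOver_mul_rpow_le {T : Geometry.SimplicialComplex ℝ Plane}
    (B : StraightBand T) {δ ℓ σ C : ℝ} (hσ : δ * ℓ ≤ σ)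
    (hC : B.minOver (fun i => 1 / Real.sin (Real.pi - B.angleKt i)) *
      B.minOver (fun i => √(B.areaKt i)) * σ ≤ √B.N * C) :
    δ * B.minOver (fun i => 1 / Real.sin (Real.pi - B.angleKt i)) *
      B.minOver (fun i => √(B.areaKt i)) * ℓ * (B.N : ℝ) ^ (-(1 / 2) : ℝ) ≤ C := by
  have hN : 0 < (B.N : ℝ) := Nat.cast_pos.2 B.one_le_N
  rw [Real.rpow_neg hN.le, ← Real.sqrt_eq_rpow, ← div_eq_mul_inv,
    div_le_iff₀ (Real.sqrt_pos.2 hN), mul_comm C]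
  refine le_trans (le_of_eq_of_le (by ring) (mul_le_mul_of_nonneg_left hσ
    (mul_nonneg B.minOver_one_div_sin_nonneg B.minOver_sqrt_areaKt_nonneg))) hC

end FEMBand

theorem theorem2p1_general (Ω : Set FEMBand.Plane) (hΩ : IsOpen Ω)
    (hbdd : Bornology.IsBounded Ω) (hL : FEMBand.HasLipschitzBoundary Ω)
    (α : ℝ) (hα : α ∈ Set.Icc (0 : ℝ) 1) (C_u : ℝ) :
    ∃ C_L > (0 : ℝ), ∃ C₁ > (0 : ℝ), ∀ C_K C_α : ℝ, ∃ C₂ > (0 : ℝ),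
      ∀ (h : ℝ) (T : Geometry.SimplicialComplex ℝ FEMBand.Plane) (U : FEMBand.Plane → ℝ)
        (B : FEMBand.StraightBand T),
        0 < h →
        FEMBand.IsTriangulation T Ω →
        (∀ K ∈ FEMBand.elements T, Metric.diam (convexHull ℝ (K : Set FEMBand.Plane)) ≤ h) →
        U ∈ FEMBand.piecewiseLinear T →
        FEMBand.h1Seminorm Ω (fun x => FEMBand.quadratic x - U x) ≤ C_u * h ^ α →
        (∀ i ∈ Set.Icc 1 B.N,
          B.areaKt i ≤ C_K * B.areaK i ∧
          B.areaKt i ≤ C_K * B.areaK (i - 1) ∧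
          Real.sin (Real.pi - B.angleK (i - 1)) ≤
            C_α * Real.sin (Real.pi - B.angleKt i)) →
        C_L * h ^ (2 * α / 5) ≤ B.length →
        ∃ A₁ A₂ : ℝ,
          A₁ - A₂ ≤ FEMBand.h1Seminorm B.region (fun x => FEMBand.quadratic x - U x) ∧
          C₁ * B.minOver (fun i => 1 / Real.sin (Real.pi - B.angleKt i)) *
              B.minOver (fun i => Real.sqrt (B.areaKt i)) *
              B.length * (B.N : ℝ) ^ (-(1 / 2) : ℝ) ≤ A₁ ∧
          |A₂| ≤ C₂ * h ^ α := by
  obtain ⟨C_L, hC_L, δ, hδ, hosc⟩ := hL.exists_slope_oscillation hΩ hbdd α C_u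
  refine ⟨C_L, hC_L, δ, hδ, fun C_K C_α => ?_⟩
  obtain ⟨C₂, hC₂, hband⟩ := hL.exists_minOver_mul_slope_sub_slope_le hΩ hbdd hα C_u C_K C_α
  refine ⟨C₂, hC₂, fun h T U B hh hT hdiam hU herr hB hlen => ?_⟩
  obtain ⟨g, hg⟩ := FEMBand.exists_isElementGradient hU
  obtain ⟨i, hi, j, hj, hij⟩ := hosc h T U g B hh hT hU hg herr hlen
  have hupper := hband h T U g B hh hT hdiam hU hg herr hB i hi j hj
  have hnonneg : 0 ≤ C₂ * h ^ α := by positivity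
  exact ⟨C₂ * h ^ α, C₂ * h ^ α, (sub_self _).trans_le (Real.sqrt_nonneg _),
    B.mul_minOver_mul_minOver_mul_rpow_le hij.le hupper, (abs_of_nonneg hnonneg).le⟩

theorem theorem2p1 (Ω : Set FEMBand.Plane) (hΩ : FEMBand.IsPolygonalLipschitzDomain Ω)
    (α : ℝ) (hα : α ∈ Set.Icc (0 : ℝ) 1) (C_u : ℝ) :
    ∃ C_L > (0 : ℝ), ∃ C₁ > (0 : ℝ), ∀ C_K C_α : ℝ, ∃ C₂ > (0 : ℝ),
      ∀ (h : ℝ) (T : Geometry.SimplicialComplex ℝ FEMBand.Plane) (U : FEMBand.Plane → ℝ)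
        (B : FEMBand.StraightBand T),
        0 < h →
        FEMBand.IsTriangulation T Ω →
        (∀ K ∈ FEMBand.elements T, Metric.diam (convexHull ℝ (K : Set FEMBand.Plane)) ≤ h) →
        U ∈ FEMBand.piecewiseLinear T →
        FEMBand.h1Seminorm Ω (fun x => FEMBand.quadratic x - U x) ≤ C_u * h ^ α →
        (∀ i ∈ Set.Icc 1 B.N,
          B.areaKt i ≤ C_K * B.areaK i ∧
          B.areaKt i ≤ C_K * B.areaK (i - 1) ∧
          Real.sin (Real.pi - B.angleK (i - 1)) ≤
            C_α * Real.sin (Real.pi - B.angleKt i)) →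
        C_L * h ^ (2 * α / 5) ≤ B.length →
        ∃ A₁ A₂ : ℝ,
          A₁ - A₂ ≤ FEMBand.h1Seminorm B.region (fun x => FEMBand.quadratic x - U x) ∧
          C₁ * B.minOver (fun i => 1 / Real.sin (Real.pi - B.angleKt i)) *
              B.minOver (fun i => Real.sqrt (B.areaKt i)) *
              B.length * (B.N : ℝ) ^ (-(1 / 2) : ℝ) ≤ A₁ ∧
          |A₂| ≤ C₂ * h ^ α :=
  theorem2p1_general Ω hΩ.isOpen hΩ.isBounded hΩ.lipschitz α hα C_u
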